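/- Let $\mathcal F=\{f_1,\dots,f_m\}$, $m\ge 2$, consist of $m$ piecewise degree-$d$-polynomial probability densities on $\mathbb R$, $d\ge 1$, each with $n$ pieces, given as follows. The input contains real numbers $a_1\le\dots\le a_s$ with $s\le 2mn$ (the endpoints of all the pieces, sorted), and for each $j\in[m]$ indices $b_{j1}<c_{j1}\le b_{j2}<c_{j2}\le\dots\le b_{jn}<c_{jn}$ in $[s]$ and vectors $\alpha_{j1},\dots,\alpha_{jn}\in\mathbb R^{d+1}$ such that $f_j(x)=(1,x,\dots,x^d)\cdot\alpha_{j\ell}$ for $x\in[a_{b_{j\ell}},a_{c_{j\ell}})$, $\ell\in[n]$, and $f_j(x)=0$ outside these intervals. The model of computation is a real random-access machine: programs work on arrays of real numbers and of natural numbers (as indices). Each of the following costs one operation: an arithmetic operation on reals $(+,-,\times,\div)$ or on indices $(+,-,\times)$, a conversion of an index to a real, a $k$-th root of the absolute value of a real, a comparison, a memory access, an assignment, a control step, a natural-number constant, and a draw of a fresh independent sample from the standard Cauchy distribution $C(0,1)$. There is no rounding of reals to integers. There are one program of this machine and one absolute constant $C$ such that for all $m\ge 2$, all $n$, all $d\ge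 1$, all $\varepsilon,\delta\in(0,1)$ and all such families $\mathcal F$, the program, on input $m,n,d,s,\varepsilon,\delta$ and $(a,b,c,\alpha)$, always halts after at most $$C\, m(m+n)\,d^3\,\varepsilon^{-3}\ln(m/\delta)$$ operations, and outputs numbers $D_{jk}$, $j,k\in[m]$, which with probability at least $1-\delta$ satisfy $$(\forall j,k\in[m])\qquad (1-\varepsilon)D_{jk}\le \|f_j-f_k\|_1\le(1+\varepsilon)D_{jk}.$$ -/

import Mathlib

/-! ## Families of piecewise polynomial densities -/

/-- The data of `m` piecewise degree-`d`-polynomial functions, each with `n` pieces: the sorted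
list `a` of all endpoints (at most two for each piece), the indices `b j l`, `c j l` of the left
and right endpoint of the `l`-th piece of the `j`-th function, and the coefficients `α j l` of the
polynomial on that piece. -/
structure PiecewisePolyData (m n d : ℕ) where
  s : ℕ
  s_le : s ≤ 2 * m * n
  a : Fin s → ℝ
  a_mono : Monotone a
  b : Fin m → Fin n → Fin s
  c : Fin m → Fin n → Fin s
  b_lt_c : ∀ j l, b j l < c j l
  c_le_b : ∀ j l l', l < l' → c j l ≤ b j l'
  α : Fin m → Fin n → Fin (d + 1) → ℝ

/-- The `j`-th function `f_j`: it is `(1, x, …, x^d) · α j l` on the piece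
`[a (b j l), a (c j l))` and `0` outside all its pieces. -/
noncomputable def PiecewisePolyData.density {m n d : ℕ} (F : PiecewisePolyData m n d)
    (j : Fin m) (x : ℝ) : ℝ :=
  ∑ l, (Set.Ico (F.a (F.b j l)) (F.a (F.c j l))).indicator
    (fun y => ∑ i : Fin (d + 1), F.α j l i * y ^ (i : ℕ)) x

/-- A family of `m` piecewise degree-`d`-polynomial probability densities, each with `n` pieces. -/
structure PiecewisePolyFamily (m n d : ℕ) extends PiecewisePolyData m n d where
  nonneg : ∀ j x, 0 ≤ toPiecewisePolyData.density j x
  integral_eq_one : ∀ j, ∫ x, toPiecewisePolyData.density j x = 1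

/-- `‖f_j - f_k‖₁`. -/
noncomputable def PiecewisePolyFamily.l1Dist {m n d : ℕ} (F : PiecewisePolyFamily m n d)
    (j k : Fin m) : ℝ :=
  ∫ x, |F.density j x - F.density k x|

/-! ## A real random-access machine with a Cauchy sampler

Programs work on integer arrays and real arrays (finitely many names in each program, unbounded
length, computed addresses).  Every arithmetic operation (on integers or on reals), every memory
access, every comparison, every extraction of a root, every assignment, every draw of a sample
and every control step costs one unit.  Reals can influence integers only through comparisons
(there is no rounding), and a program contains no real constants. -/

namespace RealRAM

/-- Integer memory `idx A i`, real memory `val A i`, and the number of samples drawn so far. -/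
structure State where
  idx : ℕ → ℕ → ℕ
  val : ℕ → ℕ → ℝ
  drawn : ℕ

/-- Integer expressions. -/
inductive IExp where
  | lit (k : ℕ)
  | get (A : ℕ) (i : IExp)
  | add (e e' : IExp)
  | sub (e e' : IExp)
  | mul (e e' : IExp)

/-- Value of an integer expression (`sub` is truncated subtraction). -/
def IExp.eval (σ : State) : IExp → ℕ
  | .lit k => k
  | .get A i => σ.idx A (i.eval σ)
  | .add e e' => e.eval σ + e'.eval σ
  | .sub e e' => e.eval σ - e'.eval σ
  | .mul e e' => e.eval σ * e'.eval σ

/-- Number of operations used to evaluate an integer expression. -/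
def IExp.cost : IExp → ℕ
  | .lit _ => 1
  | .get _ i => i.cost + 1
  | .add e e' => e.cost + e'.cost + 1
  | .sub e e' => e.cost + e'.cost + 1
  | .mul e e' => e.cost + e'.cost + 1

/-- Real expressions. -/
inductive RExp where
  | ofIdx (e : IExp)
  | get (A : ℕ) (i : IExp)
  | add (e e' : RExp)
  | sub (e e' : RExp)
  | mul (e e' : RExp)
  | div (e e' : RExp)
  | root (k : IExp) (e : RExp)

/-- Value of a real expression.  Division by zero returns `0`; `root k e` is the `k`-th root of
`|e|` (and `1` if `k = 0`). -/
noncomputable def RExp.eval (σ : State) : RExp → ℝ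
  | .ofIdx e => (e.eval σ : ℝ)
  | .get A i => σ.val A (i.eval σ)
  | .add e e' => e.eval σ + e'.eval σ
  | .sub e e' => e.eval σ - e'.eval σ
  | .mul e e' => e.eval σ * e'.eval σ
  | .div e e' => e.eval σ / e'.eval σ
  | .root k e => |e.eval σ| ^ ((k.eval σ : ℝ)⁻¹)

/-- Number of operations used to evaluate a real expression. -/
def RExp.cost : RExp → ℕ
  | .ofIdx e => e.cost + 1
  | .get _ i => i.cost + 1
  | .add e e' => e.cost + e'.cost + 1
  | .sub e e' => e.cost + e'.cost + 1
  | .mul e e' => e.cost + e'.cost + 1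
  | .div e e' => e.cost + e'.cost + 1
  | .root k e => k.cost + e.cost + 1

/-- Tests. -/
inductive Test where
  | ilt (e e' : IExp)
  | rlt (e e' : RExp)

/-- A test holds in a state. -/
def Test.Holds (σ : State) : Test → Prop
  | .ilt e e' => e.eval σ < e'.eval σ
  | .rlt e e' => e.eval σ < e'.eval σ

/-- Number of operations used to evaluate a test. -/
def Test.cost : Test → ℕ
  | .ilt e e' => e.cost + e'.cost + 1
  | .rlt e e' => e.cost + e'.cost + 1

/-- Programs: `setIdx A i e` and `setVal A i e` assign `e` to the cell `i` of the integer (real)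
array `A`, `draw A i` stores a fresh random sample in the cell `i` of the real array `A`, and
`loop t p` is "while `t` do `p`". -/
inductive Program where
  | skip
  | setIdx (A : ℕ) (i e : IExp)
  | setVal (A : ℕ) (i : IExp) (e : RExp)
  | draw (A : ℕ) (i : IExp)
  | seq (p q : Program)
  | ite (t : Test) (p q : Program)
  | loop (t : Test) (p : Program)

/-- Write `x` into the cell `i` of the array `A`. -/
def write {X : Type} (M : ℕ → ℕ → X) (A i : ℕ) (x : X) : ℕ → ℕ → X :=
  fun A' i' => if A' = A ∧ i' = i then x else M A' i'

/-- `Exec ω p σ σ' N`: started in the state `σ`, with the samples drawn from the sequence `ω`, the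
program `p` halts in the state `σ'` after exactly `N` operations. -/
inductive Exec (ω : ℕ → ℝ) : Program → State → State → ℕ → Prop where
  | skip (σ : State) : Exec ω .skip σ σ 1
  | setIdx (A : ℕ) (i e : IExp) (σ : State) :
      Exec ω (.setIdx A i e) σ { σ with idx := write σ.idx A (i.eval σ) (e.eval σ) }
        (i.cost + e.cost + 1)
  | setVal (A : ℕ) (i : IExp) (e : RExp) (σ : State) :
      Exec ω (.setVal A i e) σ { σ with val := write σ.val A (i.eval σ) (e.eval σ) }
        (i.cost + e.cost + 1)
  | draw (A : ℕ) (i : IExp) (σ : State) :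
      Exec ω (.draw A i) σ
        { σ with val := write σ.val A (i.eval σ) (ω σ.drawn), drawn := σ.drawn + 1 }
        (i.cost + 1)
  | seq {p q : Program} {σ σ' σ'' : State} {N N' : ℕ} (hp : Exec ω p σ σ' N)
      (hq : Exec ω q σ' σ'' N') : Exec ω (.seq p q) σ σ'' (N + N')
  | ite_true {t : Test} {p q : Program} {σ σ' : State} {N : ℕ} (ht : t.Holds σ)
      (hp : Exec ω p σ σ' N) : Exec ω (.ite t p q) σ σ' (t.cost + N + 1)
  | ite_false {t : Test} {p q : Program} {σ σ' : State} {N : ℕ} (ht : ¬ t.Holds σ)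
      (hq : Exec ω q σ σ' N) : Exec ω (.ite t p q) σ σ' (t.cost + N + 1)
  | loop_true {t : Test} {p : Program} {σ σ' σ'' : State} {N N' : ℕ} (ht : t.Holds σ)
      (hp : Exec ω p σ σ' N) (hl : Exec ω (.loop t p) σ' σ'' N') :
      Exec ω (.loop t p) σ σ'' (t.cost + N + N' + 1)
  | loop_false {t : Test} {p : Program} {σ : State} (ht : ¬ t.Holds σ) :
      Exec ω (.loop t p) σ σ (t.cost + 1)

/-- For a fixed sequence of samples, the run of a program is unique. -/
theorem Exec.unique {ω : ℕ → ℝ} {p : Program} {σ σ₁ σ₂ : State} {N₁ N₂ : ℕ}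
    (h₁ : Exec ω p σ σ₁ N₁) (h₂ : Exec ω p σ σ₂ N₂) : σ₁ = σ₂ ∧ N₁ = N₂ := by
  induction h₁ generalizing σ₂ N₂ with
  | skip | setIdx | setVal | draw => cases h₂; exact ⟨rfl, rfl⟩
  | seq _ _ ihp ihq =>
    cases h₂ with
    | seq hp hq =>
      obtain ⟨rfl, rfl⟩ := ihp hp
      obtain ⟨rfl, rfl⟩ := ihq hq
      exact ⟨rfl, rfl⟩
  | ite_true ht _ ih =>
    cases h₂ with
    | ite_true _ hp => obtain ⟨rfl, rfl⟩ := ih hp; exact ⟨rfl, rfl⟩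
    | ite_false hf _ => exact absurd ht hf
  | ite_false ht _ ih =>
    cases h₂ with
    | ite_true hf _ => exact absurd hf ht
    | ite_false _ hp => obtain ⟨rfl, rfl⟩ := ih hp; exact ⟨rfl, rfl⟩
  | loop_true ht _ _ ihp ihl =>
    cases h₂ with
    | loop_true _ hp hl =>
      obtain ⟨rfl, rfl⟩ := ihp hp
      obtain ⟨rfl, rfl⟩ := ihl hl
      exact ⟨rfl, rfl⟩
    | loop_false hf => exact absurd ht hf
  | loop_false ht =>
    cases h₂ with
    | loop_true hf _ _ => exact absurd hf ht
    | loop_false _ => exact ⟨rfl, rfl⟩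

/-- The law of a sequence of independent samples from the standard Cauchy distribution. -/
noncomputable def cauchySamples : MeasureTheory.Measure (ℕ → ℝ) :=
  MeasureTheory.Measure.infinitePi fun _ : ℕ => ProbabilityTheory.cauchyMeasure 0 1

/-- The array with the entries `u 0, …, u (k - 1)`, followed by zeros. -/
def ofVec {X : Type} [Zero X] {k : ℕ} (u : Fin k → X) (p : ℕ) : X :=
  if h : p < k then u ⟨p, h⟩ else 0

/-- The row-major array of a matrix: `u i j` is at the address `i * l + j`. -/
def ofMat {X : Type} [Zero X] {k l : ℕ} (u : Fin k → Fin l → X) : ℕ → X :=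
  ofVec fun p : Fin (k * l) => u p.divNat p.modNat

/-- The input state: the integer arrays `0, 1, 2` hold `(m, n, d, s)`, `b` and `c`, the real
arrays `0, 1, 2` hold `(ε, δ)`, `a` and `α` (with `α j l i` at the address
`j * (n * (d + 1)) + (l * (d + 1) + i)`); every other cell is zero and no sample is drawn. -/
noncomputable def input {m n d : ℕ} (F : PiecewisePolyFamily m n d) (ε δ : ℝ) : State where
  idx A := match A with
    | 0 => ofVec ![m, n, d, F.s]
    | 1 => ofMat fun j l => (F.b j l : ℕ)
    | 2 => ofMat fun j l => (F.c j l : ℕ)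
    | _ => 0
  val A := match A with
    | 0 => ofVec ![ε, δ]
    | 1 => ofVec F.a
    | 2 => ofMat fun j (q : Fin (n * (d + 1))) => F.α j q.divNat q.modNat
    | _ => 0
  drawn := 0

/-- The output `D j k` of a computation on `m` densities is read from the real array `3`, at the
address `j * m + k`. -/
def output (m : ℕ) (σ : State) (j k : Fin m) : ℝ := σ.val 3 (j * m + k)

end RealRAM

/-- `D` approximates all pairwise `L₁`-distances in `F` with relative error `ε`. -/
def IsRelErrApprox {m n d : ℕ} (F : PiecewisePolyFamily m n d) (ε : ℝ)
    (D : Fin m → Fin m → ℝ) : Prop :=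
  ∀ j k, (1 - ε) * D j k ≤ F.l1Dist j k ∧ F.l1Dist j k ≤ (1 + ε) * D j k

/-- The event `E` has probability at least `p`: it contains a measurable event of probability at
least `p`. -/
def HasProbAtLeast {Ω : Type} [MeasurableSpace Ω] (μ : MeasureTheory.Measure Ω) (E : Set Ω)
    (p : ℝ) : Prop :=
  ∃ G ⊆ E, MeasurableSet G ∧ ENNReal.ofReal p ≤ μ G

/-! The program is a linear sketch in the L₁ norm. If `x₁, x₂, …` are independent standard Cauchy
variables, then `∑ gᵢ xᵢ` is distributed like `(∑ |gᵢ|) x₁` (`map_sum_cauchySamples`). So if `∑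
|gᵢ|` is close to `‖f_j - f_k‖₁`, each random sum is a Cauchy variable whose scale is the wanted
distance, and by linearity it is a difference of one sketch of `f_j` and one of `f_k`. Only `m`
sketches are needed in each round, although `m²` distances are estimated.

The `gᵢ` come from a quadrature rule. Consecutive endpoints cut the line into intervals on which
`f_j - f_k` is a polynomial `p` of degree at most `d`. The substitution `x = mid - half · cos θ`
turns `∫ |p|` into `∫ |T|` over `[0, π]`, where `T` is a sine polynomial with frequencies at most `N
= d + 1`. Its coefficients are at most `(2/π) ∫ |T|`, so its Lipschitz constant is at most `(2/π) N²
∫ |T|`, and a Riemann sum of step `π / K` has relative error `O(N² / K)`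
(`Polynomial.quadrature_error`). Hence `K = O(d² / ε)` nodes in each interval suffice, irrespective
of the coefficients.

The scale is estimated by the geometric mean of `R` independent absolute values. The logarithm of a
Cauchy variable has mean zero and a moment generating function at most `exp (κ t²)` near zero, so a
Chernoff bound gives concentration with failure probability `exp (-c R ε²)`
(`exists_geometric_mean_concentration`). With `R = O(ε⁻² log (m / δ))`, a union bound over all pairs
finishes the probabilistic part (`exists_sketch_number`).

For the running time, one round draws at most `2mnK` samples and adds each to `d + 1` moments. The
moments are kept as prefix sums over the intervals, so a piece costs `O(d)` however many intervals
it spans. A round thus costs `O(mn d³ / ε + mnd + m²)`, and multiplication by `R` gives the bound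
(`cost_le`). The machine knows neither `π` nor cosines; `K` is a power of two, `cos (π / K)` comes
from the half-angle formula, and the tables from the addition formulas. -/

/-! ## Quadrature for absolute values of polynomials at Chebyshev nodes -/

section Quadrature

open Real Finset intervalIntegral

/-- The span of `sin θ, …, sin (N θ)`. -/
def sineSpan (N : ℕ) : Submodule ℝ (ℝ → ℝ) :=
  Submodule.span ℝ ((fun (k : ℕ) (θ : ℝ) => sin ((k + 1) * θ)) '' (range N : Set ℕ))

theorem sin_mem_sineSpan {k N : ℕ} (h : k < N) :
    (fun θ : ℝ => sin ((k + 1) * θ)) ∈ sineSpan N :=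
  Submodule.subset_span ⟨k, by simpa using h, rfl⟩

theorem sineSpan_mono {M N : ℕ} (h : M ≤ N) : sineSpan M ≤ sineSpan N :=
  Submodule.span_mono (Set.image_mono (by simpa using h))

/-- Product-to-sum moves each frequency up and down by one. The lowest frequency goes down to `sin 0
= 0`, so no constant or cosine appears. -/
theorem mul_cos_mem_sineSpan {N : ℕ} {f : ℝ → ℝ} (hf : f ∈ sineSpan N) :
    (fun θ => f θ * cos θ) ∈ sineSpan (N + 1) := by
  induction hf using Submodule.span_induction with
  | mem f hf =>
    obtain ⟨k, hk, rfl⟩ := hf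
    have hk : k < N := by simpa using hk
    have key : (fun θ : ℝ => sin ((k + 1) * θ) * cos θ)
        = (1 / 2 : ℝ) • (fun θ : ℝ => sin (((k + 1 : ℕ) + 1) * θ))
          + (1 / 2 : ℝ) • (fun θ : ℝ => sin (k * θ)) := by
      funext θ
      simp only [Pi.add_apply, Pi.smul_apply, smul_eq_mul]
      have h1 : ((k + 1 : ℕ) + 1 : ℝ) * θ = (k + 1) * θ + θ := by push_cast; ring
      have h2 : (k : ℝ) * θ = (k + 1) * θ - θ := by ring
      rw [h1, h2, sin_add, sin_sub]
      ring
    rw [key]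
    refine Submodule.add_mem _ (Submodule.smul_mem _ _ (sin_mem_sineSpan (by omega)))
      (Submodule.smul_mem _ _ ?_)
    rcases k with _ | k
    · simp only [Nat.cast_zero, zero_mul, sin_zero]
      exact Submodule.zero_mem _
    · simpa using sin_mem_sineSpan (show k < N + 1 by omega)
  | zero =>
    convert (sineSpan (N + 1)).zero_mem using 1
    funext θ; simp
  | add f g _ _ hf hg =>
    convert Submodule.add_mem _ hf hg using 1
    funext θ; simp [add_mul]
  | smul a f _ hf =>
    convert Submodule.smul_mem _ a hf using 1
    funext θ; simp [mul_assoc]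

theorem cos_pow_mul_sin_mem_sineSpan (e : ℕ) :
    (fun θ => cos θ ^ e * sin θ) ∈ sineSpan (e + 1) := by
  induction e with
  | zero => simpa using sin_mem_sineSpan (show 0 < 0 + 1 by omega)
  | succ e ih =>
    convert mul_cos_mem_sineSpan ih using 2
    ring

theorem Polynomial.exists_sine_expansion (p : Polynomial ℝ) {N : ℕ} (hp : p.natDegree < N) :
    ∃ b : ℕ → ℝ, ∀ θ, p.eval (cos θ) * sin θ = ∑ k ∈ range N, b k * sin ((k + 1) * θ) := by
  have hmem : (fun θ => p.eval (cos θ) * sin θ) ∈ sineSpan N := by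
    have : (fun θ => p.eval (cos θ) * sin θ)
        = ∑ e ∈ range N, p.coeff e • fun θ => cos θ ^ e * sin θ := by
      funext θ
      simp [Polynomial.eval_eq_sum_range' hp, Finset.sum_mul, mul_assoc]
    rw [this]
    exact Submodule.sum_mem _ fun e he => Submodule.smul_mem _ _
      (sineSpan_mono (by simpa [Nat.succ_le_iff] using he) (cos_pow_mul_sin_mem_sineSpan e))
  rw [sineSpan, Submodule.mem_span_image_finset_iff_exists_fun] at hmem
  obtain ⟨b, hb⟩ := hmem
  refine ⟨fun k => if h : k ∈ range N then b ⟨k, h⟩ else 0, fun θ => ?_⟩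
  have := congrFun hb θ
  rw [← this, ← Finset.sum_coe_sort (range N)]
  simp

theorem integral_cos_int_mul {n : ℤ} (hn : n ≠ 0) : ∫ θ in (0 : ℝ)..π, cos (n * θ) = 0 := by
  have : (n : ℝ) ≠ 0 := by exact_mod_cast hn
  rw [intervalIntegral.integral_comp_mul_left _ this]
  simp [sin_int_mul_pi]

theorem integral_sin_mul_sin (j k : ℕ) :
    ∫ θ in (0 : ℝ)..π, sin ((j + 1) * θ) * sin ((k + 1) * θ) = if j = k then π / 2 else 0 := by
  have key : ∀ θ : ℝ, sin ((j + 1) * θ) * sin ((k + 1) * θ)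
      = (cos (((j - k : ℤ) : ℝ) * θ) - cos (((j + k + 2 : ℤ) : ℝ) * θ)) / 2 := by
    intro θ
    have h1 : ((j - k : ℤ) : ℝ) * θ = (j + 1) * θ - (k + 1) * θ := by push_cast; ring
    have h2 : ((j + k + 2 : ℤ) : ℝ) * θ = (j + 1) * θ + (k + 1) * θ := by push_cast; ring
    rw [h1, h2, cos_sub, cos_add]
    ring
  simp_rw [key]
  rw [intervalIntegral.integral_div, intervalIntegral.integral_sub,
    integral_cos_int_mul (by omega : (j + k + 2 : ℤ) ≠ 0)]
  · split_ifs with h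
    · subst h; simp
    · rw [integral_cos_int_mul (by omega)]; simp
  · exact Continuous.intervalIntegrable (by fun_prop) _ _
  · exact Continuous.intervalIntegrable (by fun_prop) _ _

/-- Orthogonality recovers a coefficient as an integral of `T` against a sine, and the sine is at
most one in absolute value. The bound by the L₁ norm of `T` itself is what makes the quadrature
error relative. -/
theorem abs_sine_coeff_le {N : ℕ} {b : ℕ → ℝ} {T : ℝ → ℝ}
    (hT : ∀ θ, T θ = ∑ k ∈ range N, b k * sin ((k + 1) * θ)) {j : ℕ} (hj : j < N) :
    |b j| ≤ 2 / π * ∫ θ in (0 : ℝ)..π, |T θ| := by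
  have hcont : Continuous T := by
    rw [funext hT]; fun_prop
  have h1 : ∫ θ in (0 : ℝ)..π, T θ * sin ((j + 1) * θ) = b j * (π / 2) := by
    simp_rw [hT, Finset.sum_mul, mul_assoc]
    rw [intervalIntegral.integral_finsetSum]
    · simp_rw [intervalIntegral.integral_const_mul, integral_sin_mul_sin]
      simp [hj]
    · intro i _
      exact Continuous.intervalIntegrable (by fun_prop) _ _
  have h2 : |∫ θ in (0 : ℝ)..π, T θ * sin ((j + 1) * θ)| ≤ ∫ θ in (0 : ℝ)..π, |T θ| := by
    refine (intervalIntegral.abs_integral_le_integral_abs pi_pos.le).trans ?_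
    refine intervalIntegral.integral_mono_on pi_pos.le
      (Continuous.intervalIntegrable (by fun_prop) _ _)
      (Continuous.intervalIntegrable (by fun_prop) _ _) fun θ _ => ?_
    rw [abs_mul]
    exact mul_le_of_le_one_right (abs_nonneg _) (abs_sin_le_one _)
  rw [h1, abs_mul, abs_of_pos (by positivity : π / 2 > 0)] at h2
  rw [div_mul_eq_mul_div, le_div_iff₀ pi_pos]
  linarith

/-- There are `N` terms, each with Lipschitz constant at most `N` times the coefficient bound; this
is the source of `N ^ 2`. -/
theorem sine_sum_lipschitz {N : ℕ} {b : ℕ → ℝ} {T : ℝ → ℝ}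
    (hT : ∀ θ, T θ = ∑ k ∈ range N, b k * sin ((k + 1) * θ)) (x y : ℝ) :
    |T x - T y| ≤ 2 / π * (∫ θ in (0 : ℝ)..π, |T θ|) * N ^ 2 * |x - y| := by
  have hI : 0 ≤ ∫ θ in (0 : ℝ)..π, |T θ| :=
    intervalIntegral.integral_nonneg pi_pos.le fun _ _ => abs_nonneg _
  rw [hT x, hT y, ← Finset.sum_sub_distrib]
  calc _ ≤ ∑ k ∈ range N, |b k * sin ((k + 1) * x) - b k * sin ((k + 1) * y)| :=
        Finset.abs_sum_le_sum_abs _ _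
    _ ≤ ∑ k ∈ range N, (2 / π * ∫ θ in (0 : ℝ)..π, |T θ|) * (N * |x - y|) := by
        refine Finset.sum_le_sum fun k hk => ?_
        have hk : k < N := by simpa using hk
        rw [← mul_sub, abs_mul]
        refine mul_le_mul (abs_sine_coeff_le hT hk) ?_ (abs_nonneg _) (by positivity)
        refine (Real.abs_sin_sub_sin_le _ _).trans ?_
        rw [← mul_sub, abs_mul]
        gcongr
        rw [abs_of_pos (by positivity)]
        exact_mod_cast hk
    _ = _ := by simp; ring

theorem riemann_sum_error {f : ℝ → ℝ} {Λ : ℝ} (hΛ : ∀ x y, |f x - f y| ≤ Λ * |x - y|)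
    (hf : Continuous f) {h : ℝ} (hh : 0 ≤ h) (K : ℕ) :
    |(∫ x in (0 : ℝ)..(K * h), f x) - h * ∑ i ∈ range K, f (i * h)| ≤ K * (Λ * h * h) := by
  have hint : ∀ a b, IntervalIntegrable f MeasureTheory.volume a b :=
    fun a b => hf.intervalIntegrable a b
  have hsum := intervalIntegral.sum_integral_adjacent_intervals (f := f) (μ := MeasureTheory.volume)
    (a := fun i : ℕ => (i : ℝ) * h) (n := K) (fun k _ => hint _ _)
  simp only [Nat.cast_zero, zero_mul] at hsum
  have hΛ0 : 0 ≤ Λ := by simpa using (abs_nonneg _).trans (hΛ 1 0)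
  rw [← hsum, Finset.mul_sum, ← Finset.sum_sub_distrib]
  calc _ ≤ ∑ i ∈ range K, |(∫ x in (i * h)..((i + 1 : ℕ) * h), f x) - h * f (i * h)| :=
        Finset.abs_sum_le_sum_abs _ _
    _ ≤ ∑ i ∈ range K, Λ * h * h := by
        refine Finset.sum_le_sum fun i _ => ?_
        have hlen : ((i + 1 : ℕ) : ℝ) * h - i * h = h := by push_cast; ring
        have : h * f (i * h) = ∫ x in (i * h)..((i + 1 : ℕ) * h), f (i * h) := by
          rw [intervalIntegral.integral_const, hlen, smul_eq_mul]
        rw [this, ← intervalIntegral.integral_sub (hint _ _) (by simp)]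
        have := intervalIntegral.norm_integral_le_of_norm_le_const
          (a := i * h) (b := ((i + 1 : ℕ) : ℝ) * h) (C := Λ * h)
          (f := fun x => f x - f (i * h)) (fun x hx => ?_)
        · rw [hlen, abs_of_nonneg hh] at this
          exact this
        · rw [Set.uIoc_of_le (by push_cast; nlinarith)] at hx
          refine (hΛ _ _).trans ?_
          gcongr
          rw [abs_of_pos (by linarith [hx.1])]
          linarith [hx.2]
    _ = _ := by simp

/-- Relative error of the quadrature rule for `|p|` at the Chebyshev nodes. -/
theorem Polynomial.quadrature_error (p : Polynomial ℝ) {N K : ℕ} (hp : p.natDegree < N) {u v : ℝ}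
    (huv : u ≤ v) {h : ℝ} (hh : 0 < h) (h1 : h ≤ 1) (hK : K * h = π) :
    |(∫ x in u..v, |p.eval x|) - ∑ i ∈ range K, (|sin h * sin (i * h) * ((v - u) / 2)
        * p.eval ((u + v) / 2 - (v - u) / 2 * cos (i * h))|)| ≤
      3 * N ^ 2 * h * ∫ x in u..v, |p.eval x| := by
  set q : Polynomial ℝ := Polynomial.C ((v - u) / 2) *
    p.comp (Polynomial.C ((u + v) / 2) - Polynomial.C ((v - u) / 2) * Polynomial.X) with hq
  have hqdeg : q.natDegree < N := by
    refine lt_of_le_of_lt ?_ hp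
    refine (Polynomial.natDegree_C_mul_le _ _).trans ?_
    refine Polynomial.natDegree_comp_le.trans ?_
    refine (Nat.mul_le_mul_left _ (?_ : _ ≤ 1)).trans (by simp)
    refine (Polynomial.natDegree_sub_le _ _).trans ?_
    simp only [Polynomial.natDegree_C, zero_le, sup_of_le_right]
    exact (Polynomial.natDegree_C_mul_le _ _).trans Polynomial.natDegree_X_le
  have hqe : ∀ θ, q.eval (cos θ) =
      (v - u) / 2 * p.eval ((u + v) / 2 - (v - u) / 2 * cos θ) := by
    intro θ; simp [hq, Polynomial.eval_comp]
  set T : ℝ → ℝ := fun θ => q.eval (cos θ) * sin θ with hTdef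
  obtain ⟨b, hb⟩ := q.exists_sine_expansion hqdeg
  have hTc : Continuous T := by
    rw [hTdef]; fun_prop
  set I := ∫ x in u..v, |p.eval x| with hI
  have hIT : ∫ θ in (0 : ℝ)..π, |T θ| = I := by
    have := intervalIntegral.integral_comp_mul_deriv (a := 0) (b := π)
      (f := fun θ => (u + v) / 2 - (v - u) / 2 * cos θ) (f' := fun θ => (v - u) / 2 * sin θ)
      (g := fun x => |p.eval x|) (fun θ _ => ?_) (by fun_prop) (by fun_prop)
    · simp only [Function.comp, cos_zero, cos_pi] at this
      rw [show (u + v) / 2 - (v - u) / 2 * 1 = u by ring,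
        show (u + v) / 2 - (v - u) / 2 * -1 = v by ring] at this
      rw [hI, ← this]
      refine intervalIntegral.integral_congr fun θ hθ => ?_
      rw [Set.uIcc_of_le pi_pos.le] at hθ
      simp only [hTdef, hqe, abs_mul]
      rw [abs_of_nonneg (sin_nonneg_of_mem_Icc hθ), abs_of_nonneg (by linarith : 0 ≤ (v - u) / 2)]
      ring
    · simpa using ((hasDerivAt_cos θ).const_mul ((v - u) / 2)).const_sub ((u + v) / 2)
  have hI0 : 0 ≤ I := intervalIntegral.integral_nonneg huv fun _ _ => abs_nonneg _
  have hR := riemann_sum_error (f := fun θ => |T θ|) (Λ := 2 / π * I * N ^ 2)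
    (fun x y => (abs_abs_sub_abs_le_abs_sub _ _).trans (by
      have := sine_sum_lipschitz hb x y
      rwa [hIT] at this)) (by fun_prop) hh.le K
  rw [hK, hIT] at hR
  -- The length `K * h = π` of the range cancels the `1 / π` of the Lipschitz constant.
  have hR' : (K : ℝ) * (2 / π * I * N ^ 2 * h * h) = 2 * N ^ 2 * h * I := by
    calc (K : ℝ) * (2 / π * I * N ^ 2 * h * h) = (K * h) * (2 / π * I * N ^ 2 * h) := by ring
      _ = _ := by rw [hK]; field_simp
  rw [hR'] at hR
  set S := ∑ i ∈ range K, |T (i * h)| with hS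
  have hS0 : 0 ≤ S := Finset.sum_nonneg fun _ _ => abs_nonneg _
  have hsin : 0 ≤ sin h := sin_nonneg_of_nonneg_of_le_pi hh.le (by linarith [pi_gt_three])
  have hW : ∑ i ∈ range K, |sin h * sin (i * h) * ((v - u) / 2)
        * p.eval ((u + v) / 2 - (v - u) / 2 * cos (i * h))| = sin h * S := by
    rw [hS, Finset.mul_sum]
    refine Finset.sum_congr rfl fun i _ => ?_
    rw [hTdef]
    simp only [hqe]
    rw [show sin h * sin (i * h) * ((v - u) / 2)
        * p.eval ((u + v) / 2 - (v - u) / 2 * cos (i * h)) = sin h * ((v - u) / 2 *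
        p.eval ((u + v) / 2 - (v - u) / 2 * cos (i * h)) * sin (i * h)) by ring,
      abs_mul (sin h), abs_of_nonneg hsin]
  rw [hW]
  have hN : (1 : ℝ) ≤ N ^ 2 := by
    have : (1 : ℝ) ≤ N := by exact_mod_cast (by omega : 1 ≤ N)
    nlinarith
  have hs1 : sin h ≤ h := sin_le hh.le
  -- The weights carry `sin h` in place of the step `h`, since `sin h` is computable without `π`.
  -- The relative loss `h ^ 2 / 6` is below `N ^ 2 * h`, which raises the constant from 2 to 3.
  have hs2 := sin_gt_sub_cube hh
  rw [abs_le] at hR ⊢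
  have hNh : h ≤ N ^ 2 * h := by nlinarith
  have hlow : h * S - h ^ 2 / 6 * (h * S) ≤ sin h * S := by
    nlinarith
  have hsq : h ^ 2 ≤ h := by nlinarith
  constructor
  · nlinarith [mul_nonneg hI0 hh.le]
  -- If the claimed relative error is at least one, nonnegativity of the sum is enough.
  · by_cases hc : 1 - 3 * N ^ 2 * h ≤ 0
    · have : 0 ≤ sin h * S := by positivity
      nlinarith
    · have hlow' : (1 - h ^ 2 / 6) * (h * S) ≤ sin h * S := by linarith
      have : (1 - h ^ 2 / 6) * ((1 - 2 * N ^ 2 * h) * I) ≤ (1 - h ^ 2 / 6) * (h * S) := by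
        apply mul_le_mul_of_nonneg_left
        · linarith
        · nlinarith
      have h3 : h ^ 2 / 6 * I ≤ N ^ 2 * h * I := by
        apply mul_le_mul_of_nonneg_right _ hI0
        nlinarith
      have h4 : 0 ≤ h ^ 2 / 6 * (2 * N ^ 2 * h) * I := by positivity
      nlinarith

end Quadrature

/-! ## Linear combinations of independent Cauchy variables -/

section Cauchy

open MeasureTheory ProbabilityTheory Measure
open scoped Real NNReal ENNReal FourierTransform

theorem cauchyMeasure_zero_one :
    cauchyMeasure 0 1 = volume.withDensity (cauchyPDF 0 1) :=
  cauchyMeasure_of_scale_ne_zero 0 one_ne_zero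

theorem toReal_cauchyPDF_zero_one (x : ℝ) :
    (cauchyPDF 0 1 x).toReal = π⁻¹ * (1 + x ^ 2)⁻¹ := by
  rw [cauchyPDF_def, cauchyPDFReal_def', ENNReal.toReal_ofReal (by positivity)]
  simp

theorem integral_cauchyMeasure {E : Type*} [NormedAddCommGroup E] [NormedSpace ℝ E] (f : ℝ → E) :
    ∫ x, f x ∂(cauchyMeasure 0 1) = ∫ x, (π⁻¹ * (1 + x ^ 2)⁻¹) • f x := by
  rw [cauchyMeasure_zero_one, integral_withDensity_eq_integral_toReal_smul₀
    (measurable_cauchyPDF 0 1).aemeasurable (by simp [cauchyPDF_def])]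
  simp_rw [toReal_cauchyPDF_zero_one]

theorem integrable_cauchyMeasure_iff {f : ℝ → ℝ} :
    Integrable f (cauchyMeasure 0 1) ↔ Integrable fun x => (π⁻¹ * (1 + x ^ 2)⁻¹) * f x := by
  rw [cauchyMeasure_zero_one, integrable_withDensity_iff_integrable_smul'
    (measurable_cauchyPDF 0 1) (by simp [cauchyPDF_def])]
  simp_rw [toReal_cauchyPDF_zero_one, smul_eq_mul]

/-- The convention `log 0 = 0` breaks `log (c * x) = log c + log x`; this puts the exception into a
null set. -/
theorem ae_ne_zero_cauchyMeasure : ∀ᵐ x ∂(cauchyMeasure 0 1), x ≠ 0 := by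
  rw [cauchyMeasure_zero_one]
  exact (withDensity_absolutelyContinuous _ _).ae_le (Measure.ae_ne volume 0)

theorem integrable_exp_neg_abs :
    Integrable fun x : ℝ => Complex.exp (-(2 * π * |x|) : ℝ) := by
  have h1 : IntegrableOn (fun x : ℝ => Complex.exp (-(2 * π * |x|) : ℝ)) (Set.Ioi 0) := by
    refine (integrableOn_exp_mul_complex_Ioi (a := (-(2 * π) : ℝ)) (by simp [Real.pi_pos])
      0).congr_fun (fun x hx => ?_) measurableSet_Ioi
    simp [abs_of_pos (show (0 : ℝ) < x from hx)]
  have h2 : IntegrableOn (fun x : ℝ => Complex.exp (-(2 * π * |x|) : ℝ)) (Set.Iic 0) := by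
    refine (integrableOn_exp_mul_complex_Iic (a := (2 * π : ℝ)) (by simp [Real.pi_pos])
      0).congr_fun (fun x hx => ?_) measurableSet_Iic
    simp [abs_of_nonpos (show x ≤ 0 from hx)]
  rw [← integrableOn_univ, ← Set.Iic_union_Ioi (a := (0 : ℝ))]
  exact h2.union h1

/-- The two half-lines contribute `1 / (2π (1 ± iξ))`, and the sum is the Cauchy density. The rate
`2π` matches the normalization of `𝓕`, so that the scale comes out as one. -/
theorem fourier_exp_neg_abs :
    𝓕 (fun x : ℝ => Complex.exp (-(2 * π * |x|) : ℝ))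
      = fun ξ : ℝ => ((π⁻¹ * (1 + ξ ^ 2)⁻¹ : ℝ) : ℂ) := by
  funext ξ
  rw [Real.fourier_real_eq_integral_exp_smul]
  have hpi : (π : ℂ) ≠ 0 := by exact_mod_cast Real.pi_ne_zero
  have e1 : ∫ v in Set.Ioi (0 : ℝ), Complex.exp (↑(-2 * π * v * ξ) * Complex.I) •
      Complex.exp (-(2 * π * |v|) : ℝ) = 1 / (2 * π * (1 + ξ * Complex.I)) := by
    have := integral_exp_mul_complex_Ioi (a := -(2 * π * (1 + ξ * Complex.I)))
      (by simp [Real.pi_pos]) 0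
    simp only [Complex.ofReal_zero, mul_zero, Complex.exp_zero, neg_div_neg_eq] at this
    rw [← this]
    refine setIntegral_congr_fun measurableSet_Ioi fun v hv => ?_
    simp only [smul_eq_mul]
    rw [← Complex.exp_add, abs_of_pos (show (0 : ℝ) < v from hv)]
    congr 1
    push_cast
    ring
  have e2 : ∫ v in Set.Iic (0 : ℝ), Complex.exp (↑(-2 * π * v * ξ) * Complex.I) •
      Complex.exp (-(2 * π * |v|) : ℝ) = 1 / (2 * π * (1 - ξ * Complex.I)) := by
    have := integral_exp_mul_complex_Iic (a := 2 * π * (1 - ξ * Complex.I))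
      (by simp [Real.pi_pos]) 0
    simp only [Complex.ofReal_zero, mul_zero, Complex.exp_zero] at this
    rw [← this]
    refine setIntegral_congr_fun measurableSet_Iic fun v hv => ?_
    simp only [smul_eq_mul]
    rw [← Complex.exp_add, abs_of_nonpos (show v ≤ 0 from hv)]
    congr 1
    push_cast
    ring
  have hint : Integrable fun v : ℝ => Complex.exp (↑(-2 * π * v * ξ) * Complex.I) •
      Complex.exp (-(2 * π * |v|) : ℝ) := by
    refine integrable_exp_neg_abs.bdd_mul (c := 1) (by fun_prop) (ae_of_all _ fun v => ?_)
    rw [Complex.norm_exp_ofReal_mul_I]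
  rw [← intervalIntegral.integral_Iic_add_Ioi (b := (0 : ℝ)) hint.integrableOn hint.integrableOn,
    e1, e2]
  have h1 : (1 + ξ * Complex.I : ℂ) ≠ 0 := fun h => by simpa using congrArg Complex.re h
  have h2 : (1 - ξ * Complex.I : ℂ) ≠ 0 := fun h => by simpa using congrArg Complex.re h
  have h3 : (1 + (ξ : ℂ) ^ 2) = (1 + ξ * Complex.I) * (1 - ξ * Complex.I) := by
    ring_nf; simp
  push_cast
  rw [h3]
  field_simp
  ring

/-- Fourier inversion applied to `fourier_exp_neg_abs`, evaluated at `t / (2 * π)`; no contour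
integral is needed. -/
theorem charFun_cauchyMeasure (t : ℝ) :
    charFun (cauchyMeasure 0 1) t = Complex.exp (-|t| : ℝ) := by
  have hint : Integrable fun ξ : ℝ => ((π⁻¹ * (1 + ξ ^ 2)⁻¹ : ℝ) : ℂ) :=
    (integrable_inv_one_add_sq.const_mul _).ofReal
  have hinv := Continuous.fourierInv_fourier_eq
    (f := fun x : ℝ => Complex.exp (-(2 * π * |x|) : ℝ)) (by fun_prop) integrable_exp_neg_abs
    (by rw [fourier_exp_neg_abs]; exact hint)
  have := congrFun hinv (t / (2 * π))
  rw [fourier_exp_neg_abs, Real.fourierInv_eq'] at this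
  rw [charFun_apply_real, integral_cauchyMeasure]
  have hpi : (0 : ℝ) < 2 * π := by positivity
  rw [abs_div, abs_of_pos hpi, mul_div_cancel₀ _ hpi.ne'] at this
  rw [← this]
  refine integral_congr_ae (ae_of_all _ fun v => ?_)
  simp only [Complex.real_smul, smul_eq_mul]
  rw [mul_comm]
  congr 2
  have : (2 * π * inner ℝ v (t / (2 * π)) : ℝ) = t * v := by
    simp only [RCLike.inner_apply, conj_trivial]
    field_simp
  rw [this]
  push_cast
  ring

theorem iIndepFun_cauchySamples :
    iIndepFun (fun (i : ℕ) (ω : ℕ → ℝ) => ω i) RealRAM.cauchySamples :=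
  iIndepFun_infinitePi (X := fun _ x => x) (by fun_prop)

theorem map_eval_cauchySamples (i : ℕ) :
    RealRAM.cauchySamples.map (fun ω => ω i) = cauchyMeasure 0 1 :=
  infinitePi_map_eval _ i

instance : IsProbabilityMeasure RealRAM.cauchySamples := by
  unfold RealRAM.cauchySamples; infer_instance

/-- A linear combination of independent standard Cauchy variables is a scaled Cauchy variable. -/
theorem map_sum_cauchySamples {ι : Type*} [Fintype ι] (φ : ι → ℕ) (hφ : φ.Injective) (g : ι → ℝ) :
    RealRAM.cauchySamples.map (fun ω => ∑ i, g i * ω (φ i))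
      = (cauchyMeasure 0 1).map ((∑ i, |g i|) * ·) := by
  have hind : iIndepFun (fun i (ω : ℕ → ℝ) => g i * ω (φ i)) RealRAM.cauchySamples :=
    (iIndepFun_cauchySamples.precomp hφ).comp (fun i x => g i * x) (by fun_prop)
  have : IsProbabilityMeasure (RealRAM.cauchySamples.map (fun ω => ∑ i, g i * ω (φ i))) :=
    isProbabilityMeasure_map (Measurable.aemeasurable (by fun_prop))
  have : IsProbabilityMeasure ((cauchyMeasure 0 1).map ((∑ i, |g i|) * ·)) :=
    isProbabilityMeasure_map (by fun_prop)
  refine Measure.ext_of_charFun ?_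
  rw [hind.charFun_map_fun_sum_eq_prod (fun i => Measurable.aemeasurable (by fun_prop))]
  funext t
  rw [charFun_map_mul, charFun_cauchyMeasure, Finset.prod_apply]
  have : ∀ i, charFun (RealRAM.cauchySamples.map fun ω => g i * ω (φ i)) t
      = Complex.exp (-|g i * t| : ℝ) := fun i => by
    rw [charFun_map_mul_comp (Measurable.aemeasurable (by fun_prop)), map_eval_cauchySamples,
      charFun_cauchyMeasure]
  simp_rw [this]
  rw [← Complex.exp_sum]
  congr 1
  simp only [abs_mul, Finset.abs_sum_of_nonneg (fun i (_ : i ∈ Finset.univ) => abs_nonneg (g i))]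
  rw [← Complex.ofReal_sum, Finset.sum_neg_distrib, Finset.sum_mul]

/-- Functions of disjoint blocks of samples are independent. -/
theorem iIndepFun_blocks {ι : Type*} (φ : ℕ × ι → ℕ) (hφ : φ.Injective) {S : (ι → ℝ) → ℝ}
    (hS : Measurable S) :
    iIndepFun (fun (r : ℕ) (ω : ℕ → ℝ) => S fun i => ω (φ (r, i))) RealRAM.cauchySamples := by
  have hmap : RealRAM.cauchySamples.map (fun ω p => ω (φ p))
      = infinitePi fun _ : ℕ × ι => cauchyMeasure 0 1 :=
    map_infinitePi_infinitePi_of_inj hφ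
  have hblock : iIndepFun (fun (r : ℕ) (ω : ℕ → ℝ) (i : ι) => ω (φ (r, i)))
      RealRAM.cauchySamples := by
    rw [iIndepFun_iff_map_fun_eq_infinitePi_map (by fun_prop)]
    have h1 : RealRAM.cauchySamples.map (fun ω (r : ℕ) (i : ι) => ω (φ (r, i)))
        = (RealRAM.cauchySamples.map (fun ω p => ω (φ p))).map
          (MeasurableEquiv.curry ℕ ι ℝ) := by
      rw [Measure.map_map (by fun_prop) (by fun_prop)]
      rfl
    -- The samples read by all blocks have a product law on `ℕ × ι`; currying it gives a product
    -- over `ℕ` of the block laws, which is independence of the blocks.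
    rw [h1, hmap, infinitePi_map_curry (fun _ _ => cauchyMeasure 0 1)]
    congr 1
    funext r
    exact (map_infinitePi_infinitePi_of_inj (P := fun _ : ℕ => cauchyMeasure 0 1)
      (f := fun i : ι => φ (r, i)) (fun i j h => by simpa using hφ h)).symm
  exact hblock.comp (fun _ => S) (fun _ => hS)

end Cauchy

/-! ## Concentration of the geometric mean of Cauchy variables -/

section GeometricMean

open MeasureTheory ProbabilityTheory Measure
open scoped Real NNReal ENNReal

/-- The function is `x ^ (-1/2)` on `(0, 1]` and `x ^ (1/2)` beyond, while the density is bounded by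
`1/π` and by `x⁻² / π`. The two majorants `x ^ (-1/2)` and `x ^ (-3/2)` are integrable there; the
negative half-line follows by symmetry. -/
theorem integrable_exp_abs_log_cauchyMeasure :
    Integrable (fun x => Real.exp (|Real.log x| / 2)) (cauchyMeasure 0 1) := by
  rw [integrable_cauchyMeasure_iff]
  set F : ℝ → ℝ := fun x => π⁻¹ * (1 + x ^ 2)⁻¹ * Real.exp (|Real.log x| / 2) with hF
  have hFm : Measurable F := by rw [hF]; fun_prop
  have hF0 : ∀ x, 0 ≤ F x := fun x => by rw [hF]; positivity
  have h01 : IntegrableOn F (Set.Ioc 0 1) := by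
    have hrp : IntegrableOn (fun x : ℝ => π⁻¹ * x ^ (-(1 / 2) : ℝ)) (Set.Ioc 0 1) := by
      have := (intervalIntegral.intervalIntegrable_rpow' (a := 0) (b := 1)
        (r := -(1 / 2)) (by norm_num)).const_mul π⁻¹
      rwa [intervalIntegrable_iff_integrableOn_Ioc_of_le zero_le_one] at this
    refine hrp.mono' hFm.aestronglyMeasurable
      ((ae_restrict_iff' measurableSet_Ioc).2 (ae_of_all _ fun x hx => ?_))
    rw [Real.norm_of_nonneg (hF0 x), hF]
    simp only
    rw [abs_of_nonpos (Real.log_nonpos hx.1.le hx.2), Real.rpow_def_of_pos hx.1,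
      show -Real.log x / 2 = Real.log x * -(1 / 2) by ring]
    refine mul_le_mul_of_nonneg_right ?_ (Real.exp_pos _).le
    refine mul_le_of_le_one_right (by positivity) (inv_le_one_of_one_le₀ ?_)
    nlinarith [sq_nonneg x]
  have h1 : IntegrableOn F (Set.Ioi 1) := by
    have hrp : IntegrableOn (fun x : ℝ => π⁻¹ * x ^ (-(3 / 2) : ℝ)) (Set.Ioi 1) :=
      (integrableOn_Ioi_rpow_of_lt (by norm_num) zero_lt_one).const_mul _
    refine hrp.mono' hFm.aestronglyMeasurable
      ((ae_restrict_iff' measurableSet_Ioi).2 (ae_of_all _ fun x hx => ?_))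
    have hx1 : (1 : ℝ) < x := hx
    have hx0 : (0 : ℝ) < x := by linarith
    rw [Real.norm_of_nonneg (hF0 x), hF]
    simp only
    rw [abs_of_nonneg (Real.log_nonneg hx1.le), mul_assoc]
    refine mul_le_mul_of_nonneg_left ?_ (by positivity)
    have h2 : (1 + x ^ 2)⁻¹ ≤ Real.exp (Real.log x * -2) := by
      rw [← Real.rpow_def_of_pos hx0, Real.rpow_neg hx0.le, Real.rpow_two]
      exact inv_anti₀ (by positivity) (by linarith)
    calc _ ≤ Real.exp (Real.log x * -2) * Real.exp (Real.log x / 2) := by gcongr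
      _ = _ := by rw [← Real.exp_add, Real.rpow_def_of_pos hx0]; congr 1; ring
  have hpos : IntegrableOn F (Set.Ioi 0) := by
    rw [← Set.Ioc_union_Ioi_eq_Ioi (zero_le_one (α := ℝ))]
    exact h01.union h1
  have hneg : IntegrableOn F (Set.Iic 0) := by
    rw [← Measure.map_neg_eq_self (volume : Measure ℝ)]
    have m : MeasurableEmbedding fun x : ℝ => -x := (Homeomorph.neg ℝ).measurableEmbedding
    rw [m.integrableOn_map_iff]
    have : F ∘ (fun x => -x) = F := by
      funext x; simp [hF]
    rw [this, Set.neg_preimage, Set.neg_Iic, neg_zero]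
    exact Iff.mpr integrableOn_Ici_iff_integrableOn_Ioi hpos
  rw [← integrableOn_univ, ← Set.Iic_union_Ioi (a := (0 : ℝ))]
  exact hneg.union hpos

/-- The standard Cauchy law on the positive half-line is invariant under `x ↦ x⁻¹`, which changes
the sign of the logarithm. This is why the geometric mean needs no correction factor. -/
theorem integral_log_cauchyMeasure : ∫ x, Real.log x ∂(cauchyMeasure 0 1) = 0 := by
  rw [integral_cauchyMeasure]
  simp only [smul_eq_mul]
  have h1 : ∫ x : ℝ, π⁻¹ * (1 + x ^ 2)⁻¹ * Real.log x
      = 2 * ∫ x in Set.Ioi (0 : ℝ), π⁻¹ * (1 + x ^ 2)⁻¹ * Real.log x := by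
    rw [← integral_comp_abs (f := fun x => π⁻¹ * (1 + x ^ 2)⁻¹ * Real.log x)]
    simp
  have h2 := integral_comp_rpow_Ioi (fun x : ℝ => π⁻¹ * (1 + x ^ 2)⁻¹ * Real.log x)
    (p := -1) (by norm_num)
  have h3 : ∫ x in Set.Ioi (0 : ℝ), (|(-1 : ℝ)| * x ^ ((-1 : ℝ) - 1)) •
      (π⁻¹ * (1 + (x ^ (-1 : ℝ)) ^ 2)⁻¹ * Real.log (x ^ (-1 : ℝ)))
      = -∫ x in Set.Ioi (0 : ℝ), π⁻¹ * (1 + x ^ 2)⁻¹ * Real.log x := by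
    rw [← integral_neg]
    refine setIntegral_congr_fun measurableSet_Ioi fun x hx => ?_
    have hx0 : (0 : ℝ) < x := hx
    simp only [smul_eq_mul, abs_neg, abs_one, one_mul]
    rw [Real.rpow_neg_one, Real.log_inv, show (-1 : ℝ) - 1 = -2 by norm_num,
      Real.rpow_neg hx0.le, Real.rpow_two]
    field_simp
    ring
  rw [h1]
  linarith

theorem exp_sub_one_sub_le (y : ℝ) : Real.exp y ≤ 1 + y + y ^ 2 * Real.exp |y| := by
  have h := Complex.norm_exp_sub_sum_le_norm_mul_exp (y : ℂ) 2
  simp only [Finset.sum_range_succ, Finset.range_zero, Finset.sum_empty, pow_zero,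
    Nat.factorial, pow_one, Complex.norm_real, Real.norm_eq_abs, sq_abs] at h
  have h2 : Complex.exp y - (0 + 1 / ((1 : ℕ) : ℂ) + (y : ℂ) / (((0 + 1) * 1 : ℕ) : ℂ))
      = ((Real.exp y - (1 + y) : ℝ) : ℂ) := by
    push_cast; ring
  rw [h2, Complex.norm_real, Real.norm_eq_abs] at h
  linarith [le_abs_self (Real.exp y - (1 + y))]

/-- From `u ^ 2 / 2 ≤ exp u` at `u = |y| / 4`, whence the 32. -/
theorem sq_mul_exp_le (y : ℝ) : y ^ 2 * Real.exp (|y| / 4) ≤ 32 * Real.exp (|y| / 2) := by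
  have h1 : y ^ 2 ≤ 32 * Real.exp (|y| / 4) := by
    have := Real.quadratic_le_exp_of_nonneg (x := |y| / 4) (by positivity)
    have h2 := sq_abs y
    nlinarith [abs_nonneg y]
  calc _ ≤ 32 * Real.exp (|y| / 4) * Real.exp (|y| / 4) := by gcongr
    _ = _ := by rw [mul_assoc, ← Real.exp_add]; ring_nf

/-- In the second-order expansion of `exp (t * log x)` the linear term integrates to zero, and for
`|t| ≤ 1 / 4` the remainder is at most `32 * t ^ 2 * exp (|log x| / 2)`, which is integrable. -/
theorem exists_mgf_log_cauchyMeasure_le :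
    ∃ κ : ℝ, 1 ≤ κ ∧ ∀ t : ℝ, |t| ≤ 1 / 4 →
      Integrable (fun x => Real.exp (t * Real.log x)) (cauchyMeasure 0 1) ∧
      mgf Real.log (cauchyMeasure 0 1) t ≤ Real.exp (κ * t ^ 2) := by
  set M := ∫ x, Real.exp (|Real.log x| / 2) ∂(cauchyMeasure 0 1) with hM
  have hint := integrable_exp_abs_log_cauchyMeasure
  have hM0 : 0 ≤ M := integral_nonneg fun _ => (Real.exp_pos _).le
  have hlog : Integrable Real.log (cauchyMeasure 0 1) := by
    refine (hint.const_mul 2).mono' (by fun_prop) (ae_of_all _ fun x => ?_)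
    have := Real.add_one_le_exp (|Real.log x| / 2)
    rw [Real.norm_eq_abs]
    linarith
  -- The extra 1 gives `1 ≤ κ`, which later keeps the Chernoff parameter `η / (4 * κ)` within `1 /
  -- 4`.
  refine ⟨32 * M + 1, by linarith, fun t ht => ?_⟩
  have hexp : Integrable (fun x => Real.exp (t * Real.log x)) (cauchyMeasure 0 1) := by
    refine hint.mono' (by fun_prop) (ae_of_all _ fun x => ?_)
    rw [Real.norm_of_nonneg (Real.exp_pos _).le, Real.exp_le_exp]
    calc t * Real.log x ≤ |t * Real.log x| := le_abs_self _
      _ = |t| * |Real.log x| := abs_mul _ _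
      _ ≤ 1 / 2 * |Real.log x| := by
        apply mul_le_mul_of_nonneg_right _ (abs_nonneg _)
        linarith
      _ = _ := by ring
  refine ⟨hexp, ?_⟩
  have hpt : ∀ x : ℝ, Real.exp (t * Real.log x)
      ≤ 1 + t * Real.log x + 32 * t ^ 2 * Real.exp (|Real.log x| / 2) := by
    intro x
    refine (exp_sub_one_sub_le _).trans ?_
    have h1 : Real.exp |t * Real.log x| ≤ Real.exp (|Real.log x| / 4) := by
      rw [Real.exp_le_exp, abs_mul]
      nlinarith [abs_nonneg (Real.log x)]
    have h2 : (t * Real.log x) ^ 2 * Real.exp |t * Real.log x|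
        ≤ t ^ 2 * (Real.log x ^ 2 * Real.exp (|Real.log x| / 4)) := by
      rw [mul_pow, mul_assoc]
      gcongr
    have h3 := mul_le_mul_of_nonneg_left (sq_mul_exp_le (Real.log x)) (sq_nonneg t)
    linarith
  calc mgf Real.log (cauchyMeasure 0 1) t
      ≤ ∫ x, (1 + t * Real.log x + 32 * t ^ 2 * Real.exp (|Real.log x| / 2))
          ∂(cauchyMeasure 0 1) :=
        integral_mono hexp (((integrable_const _).add (hlog.const_mul _)).add (hint.const_mul _))
          hpt
    _ = 1 + 32 * t ^ 2 * M := by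
        rw [integral_add (f := fun x => 1 + t * Real.log x)
          ((integrable_const _).add (hlog.const_mul _)) (hint.const_mul _),
          integral_add (integrable_const _) (hlog.const_mul _), integral_const_mul,
          integral_const_mul, integral_log_cauchyMeasure]
        simp [hM]
    _ ≤ (32 * M + 1) * t ^ 2 + 1 := by nlinarith [sq_nonneg t]
    _ ≤ _ := Real.add_one_le_exp _

/-- The geometric mean of the absolute values of `R` independent Cauchy variables of the scale
`∑ i, |g i|` is concentrated around this scale. -/
theorem exists_geometric_mean_concentration :
    ∃ κ : ℝ, 0 < κ ∧ ∀ (ι : Type) [Fintype ι] (φ : ℕ × ι → ℕ) (g : ι → ℝ) (R : ℕ) (η : ℝ),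
      φ.Injective → 0 < R → 0 < η → η ≤ 1 →
      ∃ G : Set (ℕ → ℝ), MeasurableSet G ∧
        RealRAM.cauchySamples Gᶜ ≤ ENNReal.ofReal (2 * Real.exp (-(κ * R * η ^ 2))) ∧
        ∀ ω ∈ G, Real.exp (-η) * ∑ i, |g i| ≤
            |∏ r ∈ Finset.range R, ∑ i, g i * ω (φ (r, i))| ^ ((R : ℝ)⁻¹) ∧
          |∏ r ∈ Finset.range R, ∑ i, g i * ω (φ (r, i))| ^ ((R : ℝ)⁻¹) ≤
            Real.exp η * ∑ i, |g i| := by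
  obtain ⟨κ, hκ1, hκ⟩ := exists_mgf_log_cauchyMeasure_le
  refine ⟨1 / (16 * κ), by positivity, fun ι _ φ g R η hφ hR hη hη1 => ?_⟩
  set c := ∑ i, |g i| with hc
  have hR0 : (0 : ℝ) < R := by exact_mod_cast hR
  -- For scale zero the logarithms are useless, but then every sum vanishes and, as `R` is positive,
  -- so does the root.
  rcases (Finset.sum_nonneg fun i (_ : i ∈ Finset.univ) => abs_nonneg (g i)).eq_or_lt with h0 | h0
  · refine ⟨Set.univ, MeasurableSet.univ, by simp, fun ω _ => ?_⟩
    have hg : ∀ i, g i = 0 := by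
      intro i
      have := (Finset.sum_eq_zero_iff_of_nonneg
        (fun i (_ : i ∈ Finset.univ) => abs_nonneg (g i))).1 h0.symm i (Finset.mem_univ i)
      simpa using this
    rw [hc, ← h0]
    have : ∏ r ∈ Finset.range R, ∑ i, g i * ω (φ (r, i)) = 0 :=
      Finset.prod_eq_zero (Finset.mem_range.2 hR) (by simp [hg])
    rw [this, abs_zero, Real.zero_rpow (inv_ne_zero hR0.ne')]
    simp
  rw [← hc] at h0
  set X : ℕ → (ℕ → ℝ) → ℝ := fun r ω => ∑ i, g i * ω (φ (r, i)) with hX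
  set Y : ℕ → (ℕ → ℝ) → ℝ := fun r ω => Real.log (X r ω) - Real.log c with hY
  have hXm : ∀ r, Measurable (X r) := fun r => by rw [hX]; fun_prop
  have hYm : ∀ r, Measurable (Y r) := fun r => by rw [hY]; fun_prop
  have hlaw : ∀ r, RealRAM.cauchySamples.map (X r) = (cauchyMeasure 0 1).map (c * ·) := fun r =>
    map_sum_cauchySamples (fun i => φ (r, i)) (fun i j h => by simpa using hφ h) g
  have hne : ∀ r, ∀ᵐ ω ∂(RealRAM.cauchySamples), X r ω ≠ 0 := fun r => by
    have h1 : ∀ᵐ x ∂((cauchyMeasure 0 1).map (c * ·)), x ≠ 0 := by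
      rw [ae_map_iff (Measurable.aemeasurable (by fun_prop))
        (show MeasurableSet {x : ℝ | x ≠ 0} from (measurableSet_singleton (0 : ℝ)).compl)]
      filter_upwards [ae_ne_zero_cauchyMeasure] with x hx using mul_ne_zero h0.ne' hx
    rw [← hlaw r] at h1
    exact ae_of_ae_map (hXm r).aemeasurable h1
  have hYlaw : ∀ r, IdentDistrib (Y r) Real.log RealRAM.cauchySamples (cauchyMeasure 0 1) :=
    fun r => by
      refine ⟨(hYm r).aemeasurable, by fun_prop, ?_⟩
      have h1 : RealRAM.cauchySamples.map (Y r)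
          = (RealRAM.cauchySamples.map (X r)).map (fun x => Real.log x - Real.log c) := by
        rw [Measure.map_map (by fun_prop) (hXm r)]; rfl
      rw [h1, hlaw r, Measure.map_map (by fun_prop) (by fun_prop)]
      refine Measure.map_congr ?_
      filter_upwards [ae_ne_zero_cauchyMeasure] with x hx
      simp only [Function.comp]
      rw [Real.log_mul h0.ne' hx]
      ring
  have hind : iIndepFun Y RealRAM.cauchySamples :=
    iIndepFun_blocks φ hφ (S := fun u => Real.log (∑ i, g i * u i) - Real.log c) (by fun_prop)
  have hmgf : ∀ t : ℝ, |t| ≤ 1 / 4 →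
      Integrable (fun ω => Real.exp (t * (∑ r ∈ Finset.range R, Y r) ω)) RealRAM.cauchySamples ∧
      mgf (∑ r ∈ Finset.range R, Y r) RealRAM.cauchySamples t ≤ Real.exp (R * (κ * t ^ 2)) := by
    intro t ht
    obtain ⟨h1, h2⟩ := hκ t ht
    constructor
    · refine hind.integrable_exp_mul_sum hYm fun r _ => ?_
      exact ((hYlaw r).comp (u := fun x => Real.exp (t * x)) (by fun_prop)).integrable_iff.2 h1
    · rw [hind.mgf_sum hYm, Real.exp_nat_mul, ← Finset.card_range R, ← Finset.prod_const,
        Finset.card_range]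
      refine Finset.prod_le_prod (fun _ _ => mgf_nonneg) fun r _ => ?_
      rw [mgf_congr_of_identDistrib _ _ (hYlaw r)]
      exact h2
  set S := ∑ r ∈ Finset.range R, Y r with hS
  have hSm : Measurable S := by
    rw [hS, Finset.sum_fn]
    exact Finset.measurable_sum _ fun r _ => hYm r
  -- With this `t` the quadratic term is a quarter of the linear one, so the exponent is at most
  -- `-(3/4) t R η`, better than the claimed `-(1/4) t R η`.
  set t := η / (4 * κ) with ht
  have ht0 : 0 < t := by positivity
  have ht4 : t ≤ 1 / 4 := by
    rw [ht, div_le_div_iff₀ (by positivity) (by norm_num)]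
    nlinarith
  have hkt : -t * (R * η) + R * (κ * t ^ 2) ≤ -(1 / (16 * κ) * R * η ^ 2) := by
    have : κ * t = η / 4 := by rw [ht]; field_simp
    have h2 : -t * (R * η) + R * (κ * t ^ 2) = -(3 * R * η / 4) * t := by
      rw [show R * (κ * t ^ 2) = R * t * (κ * t) by ring, this]; ring
    have h3 : 1 / (16 * κ) * R * η ^ 2 = R * η / 4 * t := by
      rw [ht]; field_simp; norm_num
    rw [h2, h3]
    have : 0 < R * η * t := by positivity
    linarith
  have htail1 : RealRAM.cauchySamples.real {ω | R * η ≤ S ω}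
      ≤ Real.exp (-(1 / (16 * κ) * R * η ^ 2)) := by
    obtain ⟨h1, h2⟩ := hmgf t (by rwa [abs_of_pos ht0])
    refine (measure_ge_le_exp_mul_mgf (R * η) ht0.le h1).trans ?_
    refine (mul_le_mul_of_nonneg_left h2 (Real.exp_pos _).le).trans ?_
    rw [← Real.exp_add]
    exact Real.exp_le_exp.2 hkt
  have htail2 : RealRAM.cauchySamples.real {ω | S ω ≤ -(R * η)}
      ≤ Real.exp (-(1 / (16 * κ) * R * η ^ 2)) := by
    obtain ⟨h1, h2⟩ := hmgf (-t) (by rwa [abs_neg, abs_of_pos ht0])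
    refine (measure_le_le_exp_mul_mgf (-(R * η)) (by linarith) h1).trans ?_
    refine (mul_le_mul_of_nonneg_left h2 (Real.exp_pos _).le).trans ?_
    rw [← Real.exp_add]
    refine Real.exp_le_exp.2 (le_trans (le_of_eq ?_) hkt)
    ring
  -- Besides the two tails, the null event that a factor vanishes is removed, so that the logarithm
  -- of the product is the sum of the logarithms.
  set G : Set (ℕ → ℝ) := {ω | ∀ r ∈ Finset.range R, X r ω ≠ 0} ∩
    ({ω | R * η ≤ S ω} ∪ {ω | S ω ≤ -(R * η)})ᶜ with hG
  refine ⟨G, ?_, ?_, fun ω hω => ?_⟩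
  · refine MeasurableSet.inter ?_ ((measurableSet_le measurable_const hSm).union
      (measurableSet_le hSm measurable_const)).compl
    rw [show {ω | ∀ r ∈ Finset.range R, X r ω ≠ 0}
      = ⋂ r ∈ Finset.range R, X r ⁻¹' {0}ᶜ by ext; simp]
    exact Finset.measurableSet_biInter _ fun r _ =>
      hXm r (measurableSet_singleton (0 : ℝ)).compl
  · rw [hG, Set.compl_inter, compl_compl]
    refine (measure_union_le _ _).trans ?_
    have hz : RealRAM.cauchySamples {ω | ∀ r ∈ Finset.range R, X r ω ≠ 0}ᶜ = 0 := by
      rw [← mem_ae_iff]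
      exact (Filter.eventually_all_finset _).2 fun r _ => hne r
    rw [hz, zero_add]
    refine (measure_union_le _ _).trans ?_
    rw [two_mul, ENNReal.ofReal_add (Real.exp_pos _).le (Real.exp_pos _).le]
    exact add_le_add
      ((ENNReal.le_ofReal_iff_toReal_le (measure_ne_top _ _) (Real.exp_pos _).le).2 htail1)
      ((ENNReal.le_ofReal_iff_toReal_le (measure_ne_top _ _) (Real.exp_pos _).le).2 htail2)
  · obtain ⟨hω1, hω2⟩ := hω
    simp only [Set.mem_compl_iff, Set.mem_union, Set.mem_ofPred_eq, not_or, not_le] at hω2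
    have hω1 : ∀ r ∈ Finset.range R, X r ω ≠ 0 := hω1
    change Real.exp (-η) * c ≤ |∏ r ∈ Finset.range R, X r ω| ^ ((R : ℝ)⁻¹) ∧
      |∏ r ∈ Finset.range R, X r ω| ^ ((R : ℝ)⁻¹) ≤ Real.exp η * c
    have hP : 0 < |∏ r ∈ Finset.range R, X r ω| := abs_pos.2 (Finset.prod_ne_zero_iff.2 hω1)
    have hSω : S ω = Real.log (∏ r ∈ Finset.range R, X r ω) - R * Real.log c := by
      rw [hS, Finset.sum_apply, Real.log_prod hω1]
      simp [hY]
    have hval : |∏ r ∈ Finset.range R, X r ω| ^ ((R : ℝ)⁻¹) = Real.exp (S ω / R) * c := by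
      rw [Real.rpow_def_of_pos hP, Real.log_abs, hSω]
      nth_rewrite 2 [← Real.exp_log h0]
      rw [← Real.exp_add]
      congr 1
      field_simp
      ring
    rw [hval]
    have e1 : -η ≤ S ω / R := by rw [le_div_iff₀ hR0]; linarith
    have e2 : S ω / R ≤ η := by rw [div_le_iff₀ hR0]; linarith
    exact ⟨mul_le_mul_of_nonneg_right (Real.exp_le_exp.2 e1) h0.le,
      mul_le_mul_of_nonneg_right (Real.exp_le_exp.2 e2) h0.le⟩

end GeometricMean

/-! ## The sketch of a family of piecewise polynomials -/

section Sketch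

open MeasureTheory Finset
open scoped Real

/-- Uniqueness of quotient and remainder; it separates both sample numbers and memory addresses. -/
theorem mul_add_inj {N a b u v : ℕ} (hu : u < N) (hv : v < N) :
    a * N + u = b * N + v ↔ a = b ∧ u = v := by
  refine ⟨fun h => ?_, fun ⟨h, h'⟩ => by rw [h, h']⟩
  have hN : 0 < N := by omega
  have h1 := congrArg (· / N) h
  have h2 := congrArg (· % N) h
  simp only [Nat.mul_add_mod_self_right, Nat.mod_eq_of_lt hu, Nat.mod_eq_of_lt hv] at h2
  simp only [mul_comm _ N, Nat.mul_add_div hN, Nat.div_eq_of_lt hu, Nat.div_eq_of_lt hv] at h1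
  exact ⟨by simpa using h1, h2⟩

namespace PiecewisePolyData

variable {m n d : ℕ} (F : PiecewisePolyData m n d)

/-- The `t`-th endpoint. -/
noncomputable def endpt (t : ℕ) : ℝ := RealRAM.ofVec F.a t

/-- The polynomial that agrees with the `j`-th function between the endpoints `t` and `t + 1`. -/
noncomputable def piecePoly (j : Fin m) (t : ℕ) : Polynomial ℝ :=
  ∑ l, if (F.b j l : ℕ) ≤ t ∧ t < F.c j l then
    ∑ i : Fin (d + 1), Polynomial.C (F.α j l i) * Polynomial.X ^ (i : ℕ) else 0

theorem natDegree_piecePoly_lt (j : Fin m) (t : ℕ) : (F.piecePoly j t).natDegree < d + 1 := by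
  rw [Nat.lt_succ_iff]
  refine Polynomial.natDegree_sum_le_of_forall_le _ _ fun l _ => ?_
  split_ifs
  · refine Polynomial.natDegree_sum_le_of_forall_le _ _ fun i _ => ?_
    exact (Polynomial.natDegree_C_mul_X_pow_le _ _).trans (by omega)
  · simp

theorem endpt_fin (t : Fin F.s) : F.endpt t = F.a t := by
  simp [endpt, RealRAM.ofVec]

theorem endpt_mono {t u : ℕ} (h : t ≤ u) (hu : u < F.s) : F.endpt t ≤ F.endpt u := by
  have := F.a_mono (a := ⟨t, by omega⟩) (b := ⟨u, hu⟩) h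
  rwa [← endpt_fin, ← endpt_fin] at this

/-- Since `x` lies in the interval from endpoint `t` to endpoint `t + 1`, comparing `x` with an
endpoint is the same as comparing indices. Repeated endpoints do no harm: their intervals are empty.
-/
theorem density_eq_piecePoly (j : Fin m) {t : ℕ} (ht : t + 1 < F.s) {x : ℝ}
    (hx : x ∈ Set.Ico (F.endpt t) (F.endpt (t + 1))) :
    F.density j x = (F.piecePoly j t).eval x := by
  rw [density, piecePoly, Polynomial.eval_finsetSum]
  refine Finset.sum_congr rfl fun l _ => ?_
  have hiff : x ∈ Set.Ico (F.a (F.b j l)) (F.a (F.c j l)) ↔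
      (F.b j l : ℕ) ≤ t ∧ t < F.c j l := by
    rw [← endpt_fin, ← endpt_fin]
    constructor
    · rintro ⟨h1, h2⟩
      constructor
      · by_contra hlt
        exact absurd (hx.2.trans_le ((F.endpt_mono (by omega) (F.b j l).2).trans h1))
          (lt_irrefl _)
      · by_contra hle
        exact absurd (h2.trans_le ((F.endpt_mono (by omega) (by omega)).trans hx.1))
          (lt_irrefl _)
    · rintro ⟨h1, h2⟩
      exact ⟨(F.endpt_mono h1 (by omega)).trans hx.1,
        hx.2.trans_le (F.endpt_mono (by omega) (F.c j l).2)⟩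
  by_cases h : (F.b j l : ℕ) ≤ t ∧ t < F.c j l
  · rw [Set.indicator_of_mem (hiff.2 h), if_pos h, Polynomial.eval_finsetSum]
    simp
  · rw [Set.indicator_of_notMem (fun h' => h (hiff.1 h')), if_neg h]
    simp

theorem density_eq_zero (j : Fin m) {x : ℝ}
    (hx : x ∉ Set.Ico (F.endpt 0) (F.endpt (F.s - 1))) : F.density j x = 0 := by
  rw [density]
  refine Finset.sum_eq_zero fun l _ => Set.indicator_of_notMem (fun h => hx ?_) _
  rw [← endpt_fin, ← endpt_fin] at h
  exact ⟨(F.endpt_mono (by omega) (F.b j l).2).trans h.1,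
    h.2.trans_le (F.endpt_mono (Nat.le_sub_one_of_lt (F.c j l).2)
      (Nat.sub_one_lt_of_lt (F.c j l).2))⟩

theorem integral_abs_density_sub (j k : Fin m) :
    ∫ x, |F.density j x - F.density k x| = ∑ t ∈ range (F.s - 1),
      ∫ x in F.endpt t..F.endpt (t + 1), |(F.piecePoly j t - F.piecePoly k t).eval x| := by
  have hpiece : ∀ t < F.s - 1, ∀ x ∈ Set.Ico (F.endpt t) (F.endpt (t + 1)),
      |F.density j x - F.density k x| = |(F.piecePoly j t - F.piecePoly k t).eval x| := by
    intro t ht x hx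
    rw [F.density_eq_piecePoly j (by omega) hx, F.density_eq_piecePoly k (by omega) hx,
      Polynomial.eval_sub]
  have hae : ∀ t < F.s - 1, ∀ᵐ x, x ∈ Set.uIoc (F.endpt t) (F.endpt (t + 1)) →
      |(F.piecePoly j t - F.piecePoly k t).eval x| = |F.density j x - F.density k x| := by
    intro t ht
    -- Pieces are closed on the left but interval integrals use intervals closed on the right; the
    -- right endpoint is a null set.
    filter_upwards [Measure.ae_ne volume (F.endpt (t + 1))] with x hx hmem
    rw [Set.uIoc_of_le (F.endpt_mono (by omega) (by omega))] at hmem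
    exact (hpiece t ht x ⟨hmem.1.le, lt_of_le_of_ne hmem.2 hx⟩).symm
  have hpc : ∀ t, Continuous fun x => |(F.piecePoly j t - F.piecePoly k t).eval x| :=
    fun t => by fun_prop
  have hint : ∀ t < F.s - 1, IntervalIntegrable
      (fun x => |F.density j x - F.density k x|) volume (F.endpt t) (F.endpt (t + 1)) :=
    fun t ht => ((hpc t).intervalIntegrable _ _).congr_ae
      ((ae_restrict_iff' measurableSet_uIoc).2 (hae t ht))
  rw [Finset.sum_congr rfl fun t ht =>
    intervalIntegral.integral_congr_ae (hae t (Finset.mem_range.1 ht)),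
    intervalIntegral.sum_integral_adjacent_intervals hint]
  -- Without endpoints `F.s - 1` is truncated and there is no last endpoint; all functions are then
  -- zero.
  rcases Nat.eq_zero_or_pos F.s with hs | hs
  · have : IsEmpty (Fin F.s) := by rw [hs]; infer_instance
    have hzero : ∀ x, |F.density j x - F.density k x| = 0 := fun x => by
      rw [F.density_eq_zero j, F.density_eq_zero k, sub_zero, abs_zero] <;> simp [hs]
    simp [hzero]
  rw [intervalIntegral.integral_of_le (F.endpt_mono (Nat.zero_le _) (by omega)),
    ← integral_Ico_eq_integral_Ioc, setIntegral_eq_integral_of_forall_compl_eq_zero]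
  intro x hx
  rw [F.density_eq_zero j hx, F.density_eq_zero k hx, sub_zero, abs_zero]

/-! ### Nodes, weights and the random sketch -/

/-- The `i`-th node between the endpoints `t` and `t + 1`, for the angular step `h`. -/
noncomputable def node (h : ℝ) (t i : ℕ) : ℝ :=
  (F.endpt t + F.endpt (t + 1)) / 2 - (F.endpt (t + 1) - F.endpt t) / 2 * Real.cos (i * h)

/-- The weight of the `i`-th node between the endpoints `t` and `t + 1`. -/
noncomputable def weight (h : ℝ) (t i : ℕ) : ℝ :=
  Real.sin h * Real.sin (i * h) * ((F.endpt (t + 1) - F.endpt t) / 2)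

theorem abs_integral_sub_quadrature_le (j k : Fin m) {K : ℕ} {h : ℝ} (hh : 0 < h) (h1 : h ≤ 1)
    (hK : K * h = π) :
    |(∫ x, |F.density j x - F.density k x|) - ∑ t ∈ range (F.s - 1), ∑ i ∈ range K,
        (|F.weight h t i * (F.piecePoly j t - F.piecePoly k t).eval (F.node h t i)|)| ≤
      3 * (d + 1 : ℕ) ^ 2 * h * ∫ x, |F.density j x - F.density k x| := by
  rw [integral_abs_density_sub, ← Finset.sum_sub_distrib, Finset.mul_sum]
  refine (Finset.abs_sum_le_sum_abs _ _).trans (Finset.sum_le_sum fun t ht => ?_)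
  have ht : t < F.s - 1 := Finset.mem_range.1 ht
  have hdeg : (F.piecePoly j t - F.piecePoly k t).natDegree < d + 1 :=
    (Polynomial.natDegree_sub_le _ _).trans_lt
      (max_lt (F.natDegree_piecePoly_lt j t) (F.natDegree_piecePoly_lt k t))
  exact Polynomial.quadrature_error _ hdeg (F.endpt_mono (by omega) (by omega)) hh h1 hK

/-- The `r`-th sketch of the `j`-th function, with `K` nodes between consecutive endpoints. -/
noncomputable def sketch (K : ℕ) (ω : ℕ → ℝ) (r : ℕ) (j : Fin m) : ℝ :=
  ∑ t ∈ range (F.s - 1), ∑ i ∈ range K, ω ((r * (F.s - 1) + t) * K + i) *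
    F.weight (π / K) t i * (F.piecePoly j t).eval (F.node (π / K) t i)

/-- The coefficients of the difference of two sketches. -/
noncomputable def sketchCoeff (K : ℕ) (j k : Fin m) (p : Fin (F.s - 1) × Fin K) : ℝ :=
  F.weight (π / K) p.1 p.2 * (F.piecePoly j p.1 - F.piecePoly k p.1).eval (F.node (π / K) p.1 p.2)

theorem sketch_sub_sketch (K : ℕ) (ω : ℕ → ℝ) (r : ℕ) (j k : Fin m) :
    F.sketch K ω r j - F.sketch K ω r k = ∑ p : Fin (F.s - 1) × Fin K,
      F.sketchCoeff K j k p * ω ((r * (F.s - 1) + p.1) * K + p.2) := by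
  rw [sketch, sketch, ← Finset.sum_sub_distrib, Fintype.sum_prod_type, Finset.sum_range]
  refine Finset.sum_congr rfl fun t _ => ?_
  rw [← Finset.sum_sub_distrib, Finset.sum_range]
  refine Finset.sum_congr rfl fun i _ => ?_
  simp only [sketchCoeff, Polynomial.eval_sub]
  ring

/-- No sample is used twice, within a sketch or in different sketches; this supplies the
independence. -/
theorem drawIndex_injective (S K : ℕ) :
    Function.Injective fun q : ℕ × (Fin S × Fin K) => (q.1 * S + q.2.1) * K + q.2.2 := by
  rintro ⟨r, t, i⟩ ⟨r', t', i'⟩ h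
  obtain ⟨h1, h2⟩ := (mul_add_inj i.2 i'.2).1 h
  obtain ⟨h3, h4⟩ := (mul_add_inj t.2 t'.2).1 h1
  simp only [Prod.mk.injEq]
  exact ⟨h3, Fin.ext h4, Fin.ext h2⟩

end PiecewisePolyData

/-- The error budget: a relative error `ε / 10` for the quadrature sum `c` and a factor `exp (± ε /
4)` for the estimate `D` of `c` together stay within `ε`. -/
theorem relErr_of_bounds {ε c D I : ℝ} (hε : 0 < ε) (hε1 : ε < 1) (hI : 0 ≤ I)
    (hc : |I - c| ≤ ε / 10 * I) (h1 : Real.exp (-(ε / 4)) * c ≤ D)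
    (h2 : D ≤ Real.exp (ε / 4) * c) : (1 - ε) * D ≤ I ∧ I ≤ (1 + ε) * D := by
  rw [abs_le] at hc
  have hc0 : 0 ≤ c := by nlinarith
  have e1 : 1 - ε / 4 ≤ Real.exp (-(ε / 4)) := by linarith [Real.add_one_le_exp (-(ε / 4))]
  have e2 : Real.exp (ε / 4) * (1 - ε / 4) ≤ 1 := by
    calc _ ≤ Real.exp (ε / 4) * Real.exp (-(ε / 4)) := by gcongr
      _ = 1 := by rw [← Real.exp_add]; simp
  constructor
  · have h3 : (1 - ε / 4) * D ≤ c := by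
      calc (1 - ε / 4) * D ≤ (1 - ε / 4) * (Real.exp (ε / 4) * c) := by
            gcongr; linarith
        _ = Real.exp (ε / 4) * (1 - ε / 4) * c := by ring
        _ ≤ 1 * c := by gcongr
        _ = c := one_mul c
    by_contra hlt
    push Not at hlt
    have h4 : (1 - ε) * ((1 - ε / 4) * D) ≤ (1 - ε) * ((1 + ε / 10) * I) := by
      apply mul_le_mul_of_nonneg_left _ (by linarith)
      linarith
    have h5 : (1 - ε / 4) * I < (1 - ε / 4) * ((1 - ε) * D) :=
      mul_lt_mul_of_pos_left hlt (by linarith)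
    nlinarith [mul_nonneg hI hε.le, mul_nonneg (mul_nonneg hI hε.le) hε.le]
  · have h3 : (1 - ε / 4) * ((1 - ε / 10) * I) ≤ D := by
      refine le_trans ?_ h1
      refine mul_le_mul e1 (by linarith) ?_ (Real.exp_pos _).le
      exact mul_nonneg (by linarith) hI
    have h4 : (1 + ε) * ((1 - ε / 4) * ((1 - ε / 10) * I)) ≤ (1 + ε) * D :=
      mul_le_mul_of_nonneg_left h3 (by linarith)
    refine le_trans ?_ h4
    have : 1 ≤ (1 + ε) * ((1 - ε / 4) * (1 - ε / 10)) := by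
      nlinarith [mul_pos hε hε, mul_pos (mul_pos hε hε) hε, mul_pos hε (sub_pos.2 hε1)]
    nlinarith

/-- With enough nodes and sketches, the geometric means of the differences of the sketches
approximate all distances with high probability. -/
theorem exists_sketch_number :
    ∃ A : ℕ, 0 < A ∧ ∀ (m n d : ℕ) (F : PiecewisePolyFamily m n d) (ε δ : ℝ) (E L K R : ℕ),
      2 ≤ m → 0 < ε → ε < 1 → 0 < δ → δ < 1 → 1 ≤ E * ε → m ≤ 2 ^ L * δ →
      100 * (d + 1) ^ 2 * E ≤ K → R = A * E ^ 2 * L →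
      HasProbAtLeast RealRAM.cauchySamples
        {ω | IsRelErrApprox F ε fun j k =>
          |∏ r ∈ range R, (F.sketch K ω r j - F.sketch K ω r k)| ^ ((R : ℝ)⁻¹)} (1 - δ) := by
  obtain ⟨κ, hκ0, hκ⟩ := exists_geometric_mean_concentration
  -- At accuracy `ε / 4` the Chernoff exponent is `κ * R * ε ^ 2 / 16`, and `48 / 16 = 3` makes it
  -- at least `3 * L`.
  refine ⟨⌈48 / κ⌉₊, Nat.ceil_pos.2 (by positivity), ?_⟩
  intro m n d F ε δ E L K R hm hε hε1 hδ hδ1 hE hL hK hR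
  have hA : 48 ≤ κ * (⌈48 / κ⌉₊ : ℕ) := by
    have := Nat.le_ceil (48 / κ)
    rw [div_le_iff₀ hκ0] at this
    linarith
  have hE0 : 0 < E := by
    rcases Nat.eq_zero_or_pos E with h | h
    · rw [h] at hE; norm_num at hE
    · exact h
  have hmR : (2 : ℝ) ≤ m := by exact_mod_cast hm
  have hL0 : 0 < L := by
    rcases Nat.eq_zero_or_pos L with h | h
    · rw [h] at hL; norm_num at hL; linarith
    · exact h
  have hR0 : 0 < R := by
    rw [hR]
    exact Nat.mul_pos (Nat.mul_pos (Nat.ceil_pos.2 (by positivity)) (by positivity)) hL0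
  have hKR : 100 * ((d + 1 : ℕ) : ℝ) ^ 2 * E ≤ K := by exact_mod_cast hK
  have hN : (1 : ℝ) ≤ ((d + 1 : ℕ) : ℝ) ^ 2 := by exact_mod_cast Nat.one_le_pow _ _ (by omega)
  have hER : (1 : ℝ) ≤ E := by exact_mod_cast hE0
  have hK100 : (100 : ℝ) ≤ K := by nlinarith
  have hK0 : (0 : ℝ) < K := by linarith
  have hh0 : 0 < π / K := by positivity
  have hh1 : π / K ≤ 1 := by
    rw [div_le_one hK0]; linarith [Real.pi_le_four]
  have hKh : K * (π / K) = π := mul_div_cancel₀ _ hK0.ne'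
  -- The 100 in the lower bound for `K` is chosen for `3 * π / 100 ≤ 1 / 10`.
  have herr : 3 * ((d + 1 : ℕ) : ℝ) ^ 2 * (π / K) ≤ ε / 10 := by
    rw [mul_div_assoc', div_le_iff₀ hK0]
    have h1 : ((d + 1 : ℕ) : ℝ) ^ 2 ≤ ((d + 1 : ℕ) : ℝ) ^ 2 * (E * ε) := by nlinarith
    have h2 : 100 * ((d + 1 : ℕ) : ℝ) ^ 2 * E * ε ≤ K * ε := by gcongr
    have h3 : 3 * ((d + 1 : ℕ) : ℝ) ^ 2 * π ≤ 3 * ((d + 1 : ℕ) : ℝ) ^ 2 * 3.15 := by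
      gcongr; exact Real.pi_lt_d2.le
    nlinarith
  have hchoice : ∀ jk : Fin m × Fin m, _ := fun jk =>
    hκ (Fin (F.s - 1) × Fin K) (fun q => (q.1 * (F.s - 1) + q.2.1) * K + q.2.2)
      (F.sketchCoeff K jk.1 jk.2) R (ε / 4)
      (PiecewisePolyData.drawIndex_injective (F.s - 1) K) hR0 (by positivity) (by linarith)
  choose G hGm hGp hGb using hchoice
  -- As `exp (-L) ≤ 2 ^ (-L) ≤ δ / m`, the exponent `3 * L` gives `2 * (δ / m) ^ 3`. One factor `1 /
  -- m` absorbs the 2, and `1 / m ^ 2` pays for the union bound over ordered pairs.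
  have hexp : 2 * Real.exp (-(κ * R * (ε / 4) ^ 2)) ≤ δ / m ^ 2 := by
    have h1 : 3 * (L : ℝ) ≤ κ * R * (ε / 4) ^ 2 := by
      rw [hR]
      push_cast
      have : (1 : ℝ) ≤ (E * ε) ^ 2 := one_le_pow₀ hE
      calc 3 * (L : ℝ) ≤ (48 / 16) * L * (E * ε) ^ 2 := by nlinarith
        _ ≤ (κ * (⌈48 / κ⌉₊ : ℕ) / 16) * L * (E * ε) ^ 2 := by gcongr
        _ = _ := by ring
    have h2 : Real.exp (-(L : ℝ)) ≤ δ / m := by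
      rw [Real.exp_neg, le_div_iff₀ (by positivity), inv_mul_le_iff₀ (Real.exp_pos _)]
      refine hL.trans (mul_le_mul_of_nonneg_right ?_ hδ.le)
      rw [← Real.exp_one_pow]
      gcongr
      linarith [Real.add_one_le_exp (1 : ℝ)]
    calc 2 * Real.exp (-(κ * R * (ε / 4) ^ 2)) ≤ 2 * Real.exp (-(L : ℝ)) ^ 3 := by
          rw [← Real.exp_nat_mul]
          gcongr
          push_cast
          linarith
      _ ≤ 2 * (δ / m) ^ 3 := by gcongr
      _ = (2 / m) * δ ^ 2 * (δ / m ^ 2) := by field_simp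
      _ ≤ 1 * 1 * (δ / m ^ 2) := by
          gcongr
          · rw [div_le_one (by positivity)]; exact hmR
          · exact pow_le_one₀ hδ.le hδ1.le
      _ = _ := by ring
  refine ⟨⋂ jk, G jk, fun ω hω j k => ?_, MeasurableSet.iInter hGm, ?_⟩
  · have hb := hGb (j, k) ω (Set.mem_iInter.1 hω (j, k))
    simp only [← PiecewisePolyData.sketch_sub_sketch] at hb
    have hq := F.abs_integral_sub_quadrature_le j k hh0 hh1 hKh
    have hsum : ∑ t ∈ range (F.s - 1), ∑ i ∈ range K, |F.weight (π / K) t i *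
        (F.piecePoly j t - F.piecePoly k t).eval (F.node (π / K) t i)|
        = ∑ p : Fin (F.s - 1) × Fin K, |F.sketchCoeff K j k p| := by
      rw [Fintype.sum_prod_type, Finset.sum_range]
      refine Finset.sum_congr rfl fun t _ => ?_
      rw [Finset.sum_range]
      rfl
    rw [hsum] at hq
    have hI : 0 ≤ ∫ x, |F.density j x - F.density k x| := integral_nonneg fun _ => abs_nonneg _
    exact relErr_of_bounds hε hε1 hI (hq.trans (mul_le_mul_of_nonneg_right herr hI)) hb.1 hb.2
  · have hcompl : RealRAM.cauchySamples (⋂ jk, G jk)ᶜ ≤ ENNReal.ofReal δ := by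
      rw [Set.compl_iInter]
      refine (measure_iUnion_fintype_le _ _).trans ?_
      refine (Finset.sum_le_sum fun jk _ =>
        (hGp jk).trans (ENNReal.ofReal_le_ofReal hexp)).trans ?_
      rw [Finset.sum_const, ← ENNReal.ofReal_nsmul]
      refine ENNReal.ofReal_le_ofReal (le_of_eq ?_)
      simp only [card_univ, Fintype.card_prod, Fintype.card_fin, nsmul_eq_mul]
      push_cast
      field_simp
    have hG : MeasurableSet (⋂ jk, G jk) := MeasurableSet.iInter hGm
    rw [← compl_compl (⋂ jk, G jk), prob_compl_eq_one_sub hG.compl,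
      ENNReal.ofReal_sub _ hδ.le, ENNReal.ofReal_one]
    exact tsub_le_tsub_left hcompl _

end Sketch

/-! ## Reasoning about programs -/

namespace RealRAM

/-- The program may write into the integer array `A`. -/
def Program.writesIdx (A : ℕ) : Program → Bool
  | .skip => false
  | .setIdx A' _ _ => A' == A
  | .setVal _ _ _ => false
  | .draw _ _ => false
  | .seq p q => p.writesIdx A || q.writesIdx A
  | .ite _ p q => p.writesIdx A || q.writesIdx A
  | .loop _ p => p.writesIdx A

/-- The program may write into the real array `A`. -/
def Program.writesVal (A : ℕ) : Program → Bool
  | .skip => false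
  | .setIdx _ _ _ => false
  | .setVal A' _ _ => A' == A
  | .draw A' _ => A' == A
  | .seq p q => p.writesVal A || q.writesVal A
  | .ite _ p q => p.writesVal A || q.writesVal A
  | .loop _ p => p.writesVal A

/-- The program may draw samples. -/
def Program.draws : Program → Bool
  | .skip => false
  | .setIdx _ _ _ => false
  | .setVal _ _ _ => false
  | .draw _ _ => true
  | .seq p q => p.draws || q.draws
  | .ite _ p q => p.draws || q.draws
  | .loop _ p => p.draws

/-- The two states agree wherever the program cannot change the state. -/
structure Program.Frame (p : Program) (σ σ' : State) : Prop where
  idx : ∀ A, p.writesIdx A = false → σ'.idx A = σ.idx A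
  val : ∀ A, p.writesVal A = false → σ'.val A = σ.val A
  drawn : p.draws = false → σ'.drawn = σ.drawn

theorem Program.Frame.refl (p : Program) (σ : State) : p.Frame σ σ :=
  ⟨fun _ _ => rfl, fun _ _ => rfl, fun _ => rfl⟩

theorem Program.Frame.trans {p : Program} {σ σ' σ'' : State} (h : p.Frame σ σ')
    (h' : p.Frame σ' σ'') : p.Frame σ σ'' :=
  ⟨fun A hA => (h'.idx A hA).trans (h.idx A hA), fun A hA => (h'.val A hA).trans (h.val A hA),
    fun hA => (h'.drawn hA).trans (h.drawn hA)⟩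

theorem write_of_ne {X : Type} {M : ℕ → ℕ → X} {A B i : ℕ} {x : X} (h : B ≠ A) :
    write M A i x B = M B := by
  funext j; simp [write, h]

/-- Every assignment names its array literally, so the set of arrays that a program may change is
computable from its text. For concrete programs the side conditions then hold by `rfl`, and
correctness statements need only mention what changes. -/
theorem Exec.frame {ω : ℕ → ℝ} {p : Program} {σ σ' : State} {N : ℕ} (h : Exec ω p σ σ' N) :
    p.Frame σ σ' := by
  induction h with
  | skip σ => exact .refl _ _
  | setIdx A i e σ =>
    refine ⟨fun B hB => write_of_ne ?_, fun _ _ => rfl, fun _ => rfl⟩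
    rintro rfl
    simp [Program.writesIdx] at hB
  | setVal A i e σ =>
    refine ⟨fun _ _ => rfl, fun B hB => write_of_ne ?_, fun _ => rfl⟩
    rintro rfl
    simp [Program.writesVal] at hB
  | draw A i σ =>
    refine ⟨fun _ _ => rfl, fun B hB => write_of_ne ?_, fun hd => ?_⟩
    · rintro rfl
      simp [Program.writesVal] at hB
    · simp [Program.draws] at hd
  | seq _ _ ihp ihq =>
    refine ⟨fun A hA => ?_, fun A hA => ?_, fun hA => ?_⟩
    · simp only [Program.writesIdx, Bool.or_eq_false_iff] at hA
      rw [ihq.idx A hA.2, ihp.idx A hA.1]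
    · simp only [Program.writesVal, Bool.or_eq_false_iff] at hA
      rw [ihq.val A hA.2, ihp.val A hA.1]
    · simp only [Program.draws, Bool.or_eq_false_iff] at hA
      rw [ihq.drawn hA.2, ihp.drawn hA.1]
  | ite_true _ _ ih =>
    refine ⟨fun A hA => ?_, fun A hA => ?_, fun hA => ?_⟩
    · simp only [Program.writesIdx, Bool.or_eq_false_iff] at hA
      exact ih.idx A hA.1
    · simp only [Program.writesVal, Bool.or_eq_false_iff] at hA
      exact ih.val A hA.1
    · simp only [Program.draws, Bool.or_eq_false_iff] at hA
      exact ih.drawn hA.1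
  | ite_false _ _ ih =>
    refine ⟨fun A hA => ?_, fun A hA => ?_, fun hA => ?_⟩
    · simp only [Program.writesIdx, Bool.or_eq_false_iff] at hA
      exact ih.idx A hA.2
    · simp only [Program.writesVal, Bool.or_eq_false_iff] at hA
      exact ih.val A hA.2
    · simp only [Program.draws, Bool.or_eq_false_iff] at hA
      exact ih.drawn hA.2
  | loop_true _ _ _ ihp ihl =>
    exact .trans ⟨ihp.idx, ihp.val, ihp.drawn⟩ ihl
  | loop_false _ => exact .refl _ _

/-- Started in `σ`, the program halts after at most `B` operations in a state that satisfies
`Q`. -/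
def Runs (ω : ℕ → ℝ) (p : Program) (σ : State) (B : ℕ) (Q : State → Prop) : Prop :=
  ∃ σ' N, Exec ω p σ σ' N ∧ N ≤ B ∧ Q σ'

variable {ω : ℕ → ℝ} {p q : Program} {σ : State} {B B' : ℕ} {Q Q' : State → Prop}

/-- The rule of consequence, with the frame handed to the proof of the new postcondition. -/
theorem Runs.mono (h : Runs ω p σ B Q) (hB : B ≤ B')
    (hQ : ∀ σ', p.Frame σ σ' → Q σ' → Q' σ') : Runs ω p σ B' Q' := by
  obtain ⟨σ', N, he, hN, hq⟩ := h
  exact ⟨σ', N, he, hN.trans hB, hQ σ' he.frame hq⟩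

theorem Runs.seq (h : Runs ω p σ B fun σ' => Runs ω q σ' B' Q) :
    Runs ω (.seq p q) σ (B + B') Q := by
  obtain ⟨σ', N, he, hN, σ'', N', he', hN', hq⟩ := h
  exact ⟨σ'', N + N', .seq he he', add_le_add hN hN', hq⟩

theorem Runs.setIdx {A : ℕ} {i e : IExp}
    (h : Q { σ with idx := write σ.idx A (i.eval σ) (e.eval σ) })
    (hB : i.cost + e.cost + 1 ≤ B) : Runs ω (.setIdx A i e) σ B Q :=
  ⟨_, _, .setIdx A i e σ, hB, h⟩

theorem Runs.setVal {A : ℕ} {i : IExp} {e : RExp}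
    (h : Q { σ with val := write σ.val A (i.eval σ) (e.eval σ) })
    (hB : i.cost + e.cost + 1 ≤ B) : Runs ω (.setVal A i e) σ B Q :=
  ⟨_, _, .setVal A i e σ, hB, h⟩

theorem Runs.draw {A : ℕ} {i : IExp}
    (h : Q { σ with val := write σ.val A (i.eval σ) (ω σ.drawn), drawn := σ.drawn + 1 })
    (hB : i.cost + 1 ≤ B) : Runs ω (.draw A i) σ B Q :=
  ⟨_, _, .draw A i σ, hB, h⟩

/-- A loop with the invariant `Inv i` after `i` rounds and at most `M` rounds. -/
theorem Runs.loop {t : Test} {Inv : ℕ → State → Prop} {M : ℕ} (h0 : Inv 0 σ)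
    (hstep : ∀ i σ', p.Frame σ σ' → Inv i σ' → t.Holds σ' →
      i < M ∧ Runs ω p σ' B (Inv (i + 1))) :
    Runs ω (.loop t p) σ ((M + 1) * (B + t.cost + 1))
      fun σ' => ∃ i ≤ M, Inv i σ' ∧ ¬ t.Holds σ' := by
  -- Induction on the number of rounds that remain; the final, failing test accounts for the `+ 1`.
  have key : ∀ k i σ', M - i = k → p.Frame σ σ' → i ≤ M → Inv i σ' →
      Runs ω (.loop t p) σ' ((k + 1) * (B + t.cost + 1))
        fun σ' => ∃ i ≤ M, Inv i σ' ∧ ¬ t.Holds σ' := by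
    intro k
    induction k with
    | zero =>
      intro i σ' hk hf hi hInv
      by_cases ht : t.Holds σ'
      · have := (hstep i σ' hf hInv ht).1
        omega
      · exact ⟨σ', _, .loop_false ht, by omega, i, hi, hInv, ht⟩
    | succ k ih =>
      intro i σ' hk hf hi hInv
      by_cases ht : t.Holds σ'
      · obtain ⟨σ₁, N₁, he₁, hN₁, hI₁⟩ := (hstep i σ' hf hInv ht).2
        obtain ⟨σ₂, N₂, he₂, hN₂, hI₂⟩ :=
          ih (i + 1) σ₁ (by omega) (hf.trans he₁.frame) (by omega) hI₁
        refine ⟨σ₂, _, .loop_true ht he₁ he₂, ?_, hI₂⟩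
        have : (k + 1 + 1) * (B + t.cost + 1)
          = (k + 1) * (B + t.cost + 1) + (B + t.cost + 1) := by ring
        omega
      · refine ⟨σ', _, .loop_false ht, ?_, i, hi, hInv, ht⟩
        nlinarith [Nat.zero_le (k * (B + t.cost + 1))]
  simpa using key M 0 σ (by omega) (.refl _ _) (Nat.zero_le _) h0

/-! ### Variables and counting loops -/

/-- The integer variable stored in the cell `0` of the array `A`. -/
abbrev IExp.var (A : ℕ) : IExp := .get A (.lit 0)

/-- The real variable stored in the cell `0` of the array `A`. -/
abbrev RExp.var (A : ℕ) : RExp := .get A (.lit 0)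

/-- Assignment to an integer variable. -/
abbrev Program.setI (A : ℕ) (e : IExp) : Program := .setIdx A (.lit 0) e

/-- Assignment to a real variable. -/
abbrev Program.setR (A : ℕ) (e : RExp) : Program := .setVal A (.lit 0) e

/-- `for v < e do p`. -/
def Program.forLoop (v : ℕ) (e : IExp) (p : Program) : Program :=
  .seq (.setI v (.lit 0)) (.loop (.ilt (.var v) e) (.seq p (.setI v (.add (.var v) (.lit 1)))))

/-- The rule for counting loops: neither the body nor the invariant depends on changes of the
loop variable `v`, and the bound `e` has the value `N` throughout. -/
theorem Runs.forLoop {v N : ℕ} {e : IExp} {Inv : ℕ → State → Prop}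
    (hB : B + e.cost + 13 ≤ B') (hv : p.writesIdx v = false)
    (hInv : ∀ i σ' x, Inv i σ' → Inv i { σ' with idx := write σ'.idx v 0 x })
    (he : ∀ σ', (Program.forLoop v e p).Frame σ σ' → e.eval σ' = N) (h0 : Inv 0 σ)
    (hbody : ∀ i < N, ∀ σ', (Program.forLoop v e p).Frame σ σ' → σ'.idx v 0 = i → Inv i σ' →
      Runs ω p σ' B (Inv (i + 1))) :
    Runs ω (Program.forLoop v e p) σ ((N + 1) * B') (Inv N) := by
  set P := Program.forLoop v e p with hP
  have hfset : ∀ (σ' : State) (x : ℕ), P.Frame σ' { σ' with idx := write σ'.idx v 0 x } := by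
    intro σ' x
    refine ⟨fun A hA => write_of_ne ?_, fun _ _ => rfl, fun _ => rfl⟩
    rintro rfl
    simp [hP, Program.forLoop, Program.writesIdx] at hA
  have hfp : ∀ σ' σ'', p.Frame σ' σ'' → P.Frame σ' σ'' := by
    intro σ' σ'' h
    refine ⟨fun A hA => h.idx A ?_, fun A hA => h.val A ?_, fun hA => h.drawn ?_⟩
    · simp only [hP, Program.forLoop, Program.writesIdx, Bool.or_eq_false_iff] at hA
      exact hA.2.1
    · simpa [hP, Program.forLoop, Program.writesVal] using hA
    · simpa [hP, Program.forLoop, Program.draws] using hA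
  refine Runs.mono (B := 3 + (N + 1) * ((B + 6) + (Test.ilt (.var v) e).cost + 1) )
    (Q := fun σ' => ∃ i ≤ N, (P.Frame σ σ' ∧ σ'.idx v 0 = i ∧ i ≤ N ∧ Inv i σ') ∧
      ¬ (Test.ilt (.var v) e).Holds σ')
    (Runs.seq (Runs.setIdx ?_ (by simp [IExp.cost]))) ?_ ?_
  · refine Runs.loop (Inv := fun i σ' => P.Frame σ σ' ∧ σ'.idx v 0 = i ∧ i ≤ N ∧ Inv i σ')
      ⟨hfset σ 0, by simp [write, IExp.eval], Nat.zero_le _, hInv _ _ _ h0⟩ ?_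
    rintro i σ' - ⟨hF, hi, hiN, hI⟩ ht
    have hlt : i < N := by
      simp only [Test.Holds, IExp.eval, he σ' hF, hi] at ht
      exact ht
    refine ⟨hlt, Runs.seq ((hbody i hlt σ' hF hi hI).mono le_rfl fun σ₁ hf₁ hI₁ => ?_)⟩
    have hv₁ : σ₁.idx v 0 = i := by rw [hf₁.idx v hv, hi]
    refine Runs.setIdx ?_ (by simp [IExp.cost])
    simp only [IExp.eval, hv₁]
    exact ⟨(hF.trans (hfp _ _ hf₁)).trans (hfset _ _), by simp [write], hlt, hInv _ _ _ hI₁⟩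
  · simp only [Test.cost, IExp.cost]
    -- The 3 operations of the initial assignment are charged to every round, which keeps the bound
    -- a single product.
    calc _ ≤ (N + 1) * (B + 6 + (1 + 1 + e.cost + 1) + 1 + 3) := by
          rw [mul_add (N + 1) _ 3]; omega
      _ ≤ _ := Nat.mul_le_mul_left _ (by omega)
  · rintro σ' - ⟨i, -, ⟨hF, hi, hiN, hI⟩, hnt⟩
    simp only [Test.Holds, IExp.eval, he σ' hF, hi, not_lt] at hnt
    rwa [le_antisymm hiN hnt] at hI

end RealRAM

/-! ## The program for one sketch -/

namespace RealRAM

open Finset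

/-- The address `(t + 1) * D + e` of the `e`-th moment in the row of the current interval. -/
def momentAddr : IExp := .add (.mul (.add (.var 11) (.lit 1)) (.var 8)) (.var 13)

/-- Add `y * x ^ e` to the `e`-th moment in the row of the current interval. -/
def addMoments : Program :=
  .forLoop 13 (.var 8) (.seq (.setVal 9 momentAddr (.add (.get 9 momentAddr) (.var 12)))
    (.setR 12 (.mul (.var 12) (.var 13))))

/-- Memory layout throughout. Integers: 3, 4, 5, 6 hold `E`, `L`, `R`, `K`; 7 and 8 hold `s - 1` and
`d + 1`; 10 to 16 count rounds, intervals, nodes (or table and output entries), exponents,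
functions, pieces and second functions. Reals: 3 output, 4 the power `2 ^ L * δ`, 5 and 6 cosine and
sine of `π / K`, 7 and 8 their tables, 9 prefix moments, 10 and 11 midpoint and half-length, 12 the
running `y * x ^ e`, 13 the node `x`, 14 the sample, 15 the projections. The second conclusion
protects the earlier rows of prefix sums. -/
theorem runs_addMoments (ω : ℕ → ℝ) {σ : State} {T D : ℕ} (hT : σ.idx 11 0 = T)
    (hD : σ.idx 8 0 = D) : Runs ω addMoments σ ((D + 1) * 50) fun σ' =>
      (∀ e < D, σ'.val 9 ((T + 1) * D + e)
        = σ.val 9 ((T + 1) * D + e) + σ.val 12 0 * σ.val 13 0 ^ e) ∧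
      ∀ q < (T + 1) * D, σ'.val 9 q = σ.val 9 q := by
  refine Runs.mono (Runs.forLoop (B := 25 + 7) (B' := 50) (N := D)
    (Inv := fun i σ' => (∀ e < D, σ'.val 9 ((T + 1) * D + e)
        = σ.val 9 ((T + 1) * D + e) + if e < i then σ.val 12 0 * σ.val 13 0 ^ e else 0) ∧
      (∀ q < (T + 1) * D, σ'.val 9 q = σ.val 9 q) ∧ σ'.val 12 0 = σ.val 12 0 * σ.val 13 0 ^ i)
    (by simp [IExp.cost]) rfl (fun _ _ _ h => h) ?_ (by simp) ?_) le_rfl ?_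
  · intro σ' hF
    simp [IExp.eval, hF.idx 8 rfl, hD]
  · rintro i hi σ' hF hv ⟨h1, h2, h3⟩
    have e1 : σ'.idx 11 0 = T := by rw [hF.idx 11 rfl, hT]
    have e2 : σ'.idx 8 0 = D := by rw [hF.idx 8 rfl, hD]
    have e3 : σ'.val 13 0 = σ.val 13 0 := by rw [hF.val 13 rfl]
    refine Runs.seq (Runs.setVal (Runs.setVal ?_ (by decide)) (by decide))
    simp only [IExp.eval, RExp.eval, momentAddr, write, e1, e2, e3, hv, h3]
    refine ⟨fun e he => ?_, fun q hq => ?_, ?_⟩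
    · rcases eq_or_ne e i with rfl | hne
      · simp [h1 e he]
      · have : (e < i + 1) ↔ e < i := by omega
        simp [hne, h1 e he, this]
    · have : q ≠ (T + 1) * D + i := by omega
      simp [this, h2 q hq]
    · simp [pow_succ, mul_assoc]
  · rintro σ' - ⟨h1, h2, -⟩
    exact ⟨fun e he => by rw [h1 e he, if_pos he], h2⟩

/-- Draw a sample for every node of the current interval. -/
def sampleNodes : Program :=
  .forLoop 12 (.var 6) (.seq (.draw 14 (.lit 0)) (.seq
    (.setR 12 (.mul (.var 14) (.mul (.mul (.var 6) (.get 8 (.var 12))) (.var 11)))) (.seq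
    (.setR 13 (.sub (.var 10) (.mul (.var 11) (.get 7 (.var 12))))) addMoments)))

theorem runs_sampleNodes (ω : ℕ → ℝ) {σ : State} {T D K : ℕ} (hT : σ.idx 11 0 = T)
    (hD : σ.idx 8 0 = D) (hK : σ.idx 6 0 = K) :
    Runs ω sampleNodes σ ((K + 1) * ((D + 1) * 50 + 70)) fun σ' =>
      (∀ e < D, σ'.val 9 ((T + 1) * D + e) = σ.val 9 ((T + 1) * D + e) +
        ∑ i ∈ range K, ω (σ.drawn + i) * (σ.val 6 0 * σ.val 8 i * σ.val 11 0) *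
          (σ.val 10 0 - σ.val 11 0 * σ.val 7 i) ^ e) ∧
      (∀ q < (T + 1) * D, σ'.val 9 q = σ.val 9 q) ∧ σ'.drawn = σ.drawn + K := by
  refine Runs.forLoop (B := 2 + (16 + (12 + (D + 1) * 50))) (N := K)
    (Inv := fun k σ' => (∀ e < D, σ'.val 9 ((T + 1) * D + e) = σ.val 9 ((T + 1) * D + e) +
        ∑ i ∈ range k, ω (σ.drawn + i) * (σ.val 6 0 * σ.val 8 i * σ.val 11 0) *
          (σ.val 10 0 - σ.val 11 0 * σ.val 7 i) ^ e) ∧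
      (∀ q < (T + 1) * D, σ'.val 9 q = σ.val 9 q) ∧ σ'.drawn = σ.drawn + k)
    (by simp [IExp.cost]; omega) rfl (fun _ _ _ h => h) ?_ (by simp) ?_
  · intro σ' hF
    simp [IExp.eval, hF.idx 6 rfl, hK]
  · rintro k hk σ' hF hv ⟨h1, h2, h3⟩
    have e1 : σ'.idx 11 0 = T := by rw [hF.idx 11 rfl, hT]
    have e2 : σ'.idx 8 0 = D := by rw [hF.idx 8 rfl, hD]
    refine Runs.seq (Runs.draw (Runs.seq (Runs.setVal (Runs.seq (Runs.setVal
      ((runs_addMoments ω (T := T) (D := D) ?_ ?_).mono le_rfl ?_)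
      (by decide))) (by decide))) (by decide))
    · simpa using e1
    · simpa using e2
    · rintro σ'' hF' ⟨g1, g2⟩
      refine ⟨fun e he => ?_, fun q hq => ?_, ?_⟩
      · rw [g1 e he]
        simp only [IExp.eval, RExp.eval, write, hv]
        simp [hF.val 6 rfl, hF.val 7 rfl, hF.val 8 rfl, hF.val 10 rfl, hF.val 11 rfl,
          h1 e he, h3, Finset.sum_range_succ]
        ring
      · rw [g2 q hq]
        simp [write, h2 q hq]
      · rw [hF'.drawn rfl]
        simp [h3, add_assoc]

/-- Compute the prefix sums of the moments of the random measure. -/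
def prefixMoments : Program :=
  .forLoop 11 (.var 7) (.seq
    (.forLoop 13 (.var 8)
      (.setVal 9 momentAddr (.get 9 (.add (.mul (.var 11) (.var 8)) (.var 13))))) (.seq
    (.setR 10 (.div (.add (.get 1 (.var 11)) (.get 1 (.add (.var 11) (.lit 1))))
      (.ofIdx (.lit 2)))) (.seq
    (.setR 11 (.div (.sub (.get 1 (.add (.var 11) (.lit 1))) (.get 1 (.var 11)))
      (.ofIdx (.lit 2))))
    sampleNodes)))

/-- Row `t + 1` starts as a copy of row `t` and then receives the moments of interval `t`. Row 0 is
never written, so it remains zero from one sketch to the next. -/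
theorem runs_prefixMoments (ω : ℕ → ℝ) {σ : State} {S D K : ℕ} (hS : σ.idx 7 0 = S)
    (hD : σ.idx 8 0 = D) (hK : σ.idx 6 0 = K) (h0 : ∀ e < D, σ.val 9 e = 0) :
    Runs ω prefixMoments σ ((S + 1) * ((D + 1) * 50 + (K + 1) * ((D + 1) * 50 + 70) + 70))
      fun σ' => (∀ t ≤ S, ∀ e < D, σ'.val 9 (t * D + e) =
        ∑ t' ∈ range t, ∑ i ∈ range K, ω (σ.drawn + (t' * K + i)) *
          (σ.val 6 0 * σ.val 8 i * ((σ.val 1 (t' + 1) - σ.val 1 t') / 2)) *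
          ((σ.val 1 t' + σ.val 1 (t' + 1)) / 2 -
            (σ.val 1 (t' + 1) - σ.val 1 t') / 2 * σ.val 7 i) ^ e) ∧
      σ'.drawn = σ.drawn + S * K := by
  refine Runs.forLoop
    (B := (D + 1) * 50 + (16 + (16 + (K + 1) * ((D + 1) * 50 + 70)))) (N := S)
    (Inv := fun k σ' => (∀ t ≤ k, ∀ e < D, σ'.val 9 (t * D + e) =
        ∑ t' ∈ range t, ∑ i ∈ range K, ω (σ.drawn + (t' * K + i)) *
          (σ.val 6 0 * σ.val 8 i * ((σ.val 1 (t' + 1) - σ.val 1 t') / 2)) *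
          ((σ.val 1 t' + σ.val 1 (t' + 1)) / 2 -
            (σ.val 1 (t' + 1) - σ.val 1 t') / 2 * σ.val 7 i) ^ e) ∧
      σ'.drawn = σ.drawn + k * K)
    (by simp [IExp.cost]; omega) rfl (fun _ _ _ h => h) ?_ ?_ ?_
  · intro σ' hF
    simp [IExp.eval, hF.idx 7 rfl, hS]
  · refine ⟨fun t ht e he => ?_, by simp⟩
    obtain rfl : t = 0 := by omega
    simpa using h0 e he
  · rintro k hk σ' hF hv ⟨h1, h2⟩
    have e2 : σ'.idx 8 0 = D := by rw [hF.idx 8 rfl, hD]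
    have e3 : σ'.idx 6 0 = K := by rw [hF.idx 6 rfl, hK]
    refine Runs.seq ((Runs.forLoop (B := 22) (B' := 50) (N := D)
      (Inv := fun i σ'' => (∀ e < i, σ''.val 9 ((k + 1) * D + e) = σ'.val 9 (k * D + e)) ∧
        ∀ q < (k + 1) * D, σ''.val 9 q = σ'.val 9 q)
      (by simp [IExp.cost]) rfl (fun _ _ _ h => h) ?_ (by simp) ?_).mono le_rfl ?_)
    · intro σ'' hF'
      simp [IExp.eval, hF'.idx 8 rfl, e2]
    · rintro i hi σ'' hF' hv' ⟨g1, g2⟩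
      refine Runs.setVal ?_ (by decide)
      have e4 : σ''.idx 8 0 = D := by rw [hF'.idx 8 rfl, e2]
      have e5 : σ''.idx 11 0 = k := by rw [hF'.idx 11 rfl, hv]
      simp only [IExp.eval, RExp.eval, momentAddr, write, e4, e5, hv']
      refine ⟨fun e he => ?_, fun q hq => ?_⟩
      · rcases eq_or_ne e i with rfl | hne
        · have : k * D + e < (k + 1) * D := by rw [add_mul]; omega
          simp [g2 _ this]
        · simp [hne, g1 e (by omega)]
      · have : q ≠ (k + 1) * D + i := by omega
        simp [this, g2 q hq]
    · rintro σ₁ hF₁ ⟨g1, g2⟩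
      have e4 : σ₁.idx 8 0 = D := by rw [hF₁.idx 8 rfl, e2]
      have e5 : σ₁.idx 11 0 = k := by rw [hF₁.idx 11 rfl, hv]
      have e6 : σ₁.idx 6 0 = K := by rw [hF₁.idx 6 rfl, e3]
      refine Runs.seq (Runs.setVal (Runs.seq (Runs.setVal
        ((runs_sampleNodes ω (T := k) (D := D) (K := K) ?_ ?_ ?_).mono le_rfl ?_)
        (by decide))) (by decide))
      · simpa using e5
      · simpa using e4
      · simpa using e6
      rintro σ₂ hF₂ ⟨f1, f2, f3⟩
      have hd : σ₁.drawn = σ.drawn + k * K := by rw [hF₁.drawn rfl, h2]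
      refine ⟨fun t ht e he => ?_, ?_⟩
      · rcases Nat.lt_or_ge t (k + 1) with hlt | hge
        · have hq : t * D + e < (k + 1) * D := by
            have : (t + 1) * D ≤ (k + 1) * D := Nat.mul_le_mul_right _ hlt
            rw [add_mul] at this
            omega
          rw [f2 _ hq, ← h1 t (by omega) e he, ← g2 _ hq]
          simp [write]
        · obtain rfl : t = k + 1 := by omega
          rw [f1 e he, Finset.sum_range_succ, ← h1 k le_rfl e he, ← g1 e he]
          simp [IExp.eval, RExp.eval, write, e5, hd, hF₁.val 6 rfl, hF₁.val 7 rfl,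
            hF₁.val 8 rfl, hF₁.val 1 rfl, hF.val 6 rfl, hF.val 7 rfl, hF.val 8 rfl,
            hF.val 1 rfl, add_assoc]
      · rw [f3]
        simp only [hd]
        ring

/-- The address `j * n + l` of a piece. -/
def pieceAddr : IExp := .add (.mul (.var 14) (.get 0 (.lit 1))) (.var 15)

/-- The address of a coefficient. -/
def coeffAddr : IExp := .add (.mul (.var 14) (.mul (.get 0 (.lit 1)) (.var 8)))
  (.add (.mul (.var 15) (.var 8)) (.var 13))

/-- The prefix sum at the endpoint that the array `A` assigns to the current piece. -/
def prefixAt (A : ℕ) : RExp := .get 9 (.add (.mul (.get A pieceAddr) (.var 8)) (.var 13))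

/-- Integrate all functions against the random measure. -/
def projectAll : Program :=
  .forLoop 14 (.get 0 (.lit 0)) (.seq (.setVal 15 (.var 14) (.ofIdx (.lit 0)))
    (.forLoop 15 (.get 0 (.lit 1)) (.forLoop 13 (.var 8)
      (.setVal 15 (.var 14) (.add (.get 15 (.var 14))
        (.mul (.get 2 coeffAddr) (.sub (prefixAt 2) (prefixAt 1))))))))

/-- The random integral of a monomial over a piece is a difference of two prefix sums, so the cost
does not depend on the number of intervals in the piece. -/
theorem runs_projectAll (ω : ℕ → ℝ) {σ : State} {m n D : ℕ} (hm : σ.idx 0 0 = m)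
    (hn : σ.idx 0 1 = n) (hD : σ.idx 8 0 = D) :
    Runs ω projectAll σ ((m + 1) * ((n + 1) * ((D + 1) * 80 + 20) + 30)) fun σ' =>
      ∀ j < m, σ'.val 15 j = ∑ l ∈ range n, ∑ e ∈ range D, σ.val 2 (j * (n * D) + (l * D + e)) *
        (σ.val 9 (σ.idx 2 (j * n + l) * D + e) - σ.val 9 (σ.idx 1 (j * n + l) * D + e)) := by
  set X : ℕ → ℕ → ℕ → ℝ := fun j l e => σ.val 2 (j * (n * D) + (l * D + e)) *
        (σ.val 9 (σ.idx 2 (j * n + l) * D + e) - σ.val 9 (σ.idx 1 (j * n + l) * D + e)) with hX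
  refine Runs.forLoop (B := 5 + (n + 1) * ((D + 1) * 80 + 20)) (N := m)
    (Inv := fun k σ' => ∀ j < k, σ'.val 15 j = ∑ l ∈ range n, ∑ e ∈ range D, X j l e)
    (by simp [IExp.cost]; omega) rfl (fun _ _ _ h => h) ?_ (by simp) ?_
  · intro σ' hF
    simp [IExp.eval, hF.idx 0 rfl, hm]
  rintro j hj σ₁ hF₁ hv₁ h₁
  refine Runs.seq (Runs.setVal ?_ (by decide))
  simp only [IExp.eval, RExp.eval, hv₁, Nat.cast_zero]
  refine (Runs.forLoop (B := (D + 1) * 80) (B' := (D + 1) * 80 + 20) (N := n)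
    (Inv := fun k σ' => (∀ i < j, σ'.val 15 i = σ₁.val 15 i) ∧
      σ'.val 15 j = ∑ l ∈ range k, ∑ e ∈ range D, X j l e)
    (by simp [IExp.cost]) rfl (fun _ _ _ h => h) ?_ ?_ ?_).mono le_rfl ?_
  · intro σ' hF
    simp [IExp.eval, hF.idx 0 rfl, hF₁.idx 0 rfl, hn]
  · refine ⟨fun i hi => ?_, by simp [write]⟩
    simp [write, hi.ne]
  · rintro l hl σ₂ hF₂ hv₂ ⟨h₂, h₂'⟩
    refine (Runs.forLoop (B := 60) (B' := 80) (N := D)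
      (Inv := fun k σ' => (∀ i < j, σ'.val 15 i = σ₁.val 15 i) ∧
        σ'.val 15 j = σ₂.val 15 j + ∑ e ∈ range k, X j l e)
      (by simp [IExp.cost]) rfl (fun _ _ _ h => h) ?_ ⟨h₂, by simp⟩ ?_).mono le_rfl ?_
    · intro σ' hF
      simp [IExp.eval, hF.idx 8 rfl, hF₂.idx 8 rfl, hF₁.idx 8 rfl, hD]
    · rintro e he σ₃ hF₃ hv₃ ⟨h₃, h₃'⟩
      refine Runs.setVal ?_ (by decide)
      have a0 : σ₃.idx 0 1 = n := by
        rw [hF₃.idx 0 rfl, hF₂.idx 0 rfl]; simp [hF₁.idx 0 rfl, hn]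
      have a8 : σ₃.idx 8 0 = D := by
        rw [hF₃.idx 8 rfl, hF₂.idx 8 rfl]; simp [hF₁.idx 8 rfl, hD]
      have a14 : σ₃.idx 14 0 = j := by
        rw [hF₃.idx 14 rfl, hF₂.idx 14 rfl]; simp [hv₁]
      have a15 : σ₃.idx 15 0 = l := by
        rw [hF₃.idx 15 rfl, hv₂]
      have a1 : σ₃.idx 1 = σ.idx 1 := by
        rw [hF₃.idx 1 rfl, hF₂.idx 1 rfl]; simp [hF₁.idx 1 rfl]
      have a2 : σ₃.idx 2 = σ.idx 2 := by
        rw [hF₃.idx 2 rfl, hF₂.idx 2 rfl]; simp [hF₁.idx 2 rfl]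
      have b2 : σ₃.val 2 = σ.val 2 := by
        rw [hF₃.val 2 rfl, hF₂.val 2 rfl]; simp [hF₁.val 2 rfl, write_of_ne]
      have b9 : σ₃.val 9 = σ.val 9 := by
        rw [hF₃.val 9 rfl, hF₂.val 9 rfl]; simp [hF₁.val 9 rfl, write_of_ne]
      simp only [IExp.eval, RExp.eval, coeffAddr, prefixAt, pieceAddr, a0, a8, a14, a15, a1, a2,
        b2, b9, hv₃]
      refine ⟨fun i hi => ?_, ?_⟩
      · simp [write, hi.ne, h₃ i hi]
      · simp [write, h₃', Finset.sum_range_succ, hX, add_assoc]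
    · rintro σ₃ - ⟨h₃, h₃'⟩
      exact ⟨h₃, by rw [h₃', h₂', Finset.sum_range_succ]⟩
  · rintro σ₂ - ⟨h₂, h₂'⟩ i hi
    rcases Nat.lt_succ_iff_lt_or_eq.1 hi with h | rfl
    · rw [h₂ i h, h₁ i h]
    · exact h₂'

/-- The address `j * m + k` of a pair of functions. -/
def pairAddr : IExp := .add (.mul (.var 14) (.get 0 (.lit 0))) (.var 16)

/-- Multiply every output by the difference of the corresponding projections. -/
def multiplyAll : Program :=
  .forLoop 14 (.get 0 (.lit 0)) (.forLoop 16 (.get 0 (.lit 0))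
    (.setVal 3 pairAddr (.mul (.get 3 pairAddr) (.sub (.get 15 (.var 14)) (.get 15 (.var 16))))))

theorem runs_multiplyAll (ω : ℕ → ℝ) {σ : State} {m : ℕ} (hm : σ.idx 0 0 = m) :
    Runs ω multiplyAll σ ((m + 1) * ((m + 1) * 50 + 20)) fun σ' => ∀ j < m, ∀ k < m,
      σ'.val 3 (j * m + k) = σ.val 3 (j * m + k) * (σ.val 15 j - σ.val 15 k) := by
  refine (Runs.forLoop (B := (m + 1) * 50) (B' := (m + 1) * 50 + 20) (N := m)
    (Inv := fun i σ' => ∀ j < m, ∀ k < m, σ'.val 3 (j * m + k) =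
      σ.val 3 (j * m + k) * if j < i then σ.val 15 j - σ.val 15 k else 1)
    (by simp [IExp.cost]) rfl (fun _ _ _ h => h) ?_ (by simp) ?_).mono le_rfl ?_
  · intro σ' hF
    simp [IExp.eval, hF.idx 0 rfl, hm]
  · rintro i hi σ₁ hF₁ hv₁ h₁
    refine (Runs.forLoop (B := 30) (B' := 50) (N := m)
      (Inv := fun i' σ' => ∀ j < m, ∀ k < m, σ'.val 3 (j * m + k) =
        σ₁.val 3 (j * m + k) * if j = i ∧ k < i' then σ.val 15 j - σ.val 15 k else 1)
      (by simp [IExp.cost]) rfl (fun _ _ _ h => h) ?_ (by simp) ?_).mono le_rfl ?_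
    · intro σ' hF
      simp [IExp.eval, hF.idx 0 rfl, hF₁.idx 0 rfl, hm]
    · rintro i' hi' σ₂ hF₂ hv₂ h₂
      refine Runs.setVal ?_ (by decide)
      have a0 : σ₂.idx 0 0 = m := by rw [hF₂.idx 0 rfl, hF₁.idx 0 rfl, hm]
      have a14 : σ₂.idx 14 0 = i := by rw [hF₂.idx 14 rfl, hv₁]
      have b15 : σ₂.val 15 = σ.val 15 := by rw [hF₂.val 15 rfl, hF₁.val 15 rfl]
      simp only [IExp.eval, RExp.eval, pairAddr, a0, a14, b15, hv₂]
      intro j hj k hk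
      -- Different pairs have different addresses, so the assignment affects the current pair only.
      simp only [write, true_and, mul_add_inj hk hi']
      by_cases h : j = i ∧ k = i'
      · obtain ⟨rfl, rfl⟩ := h
        simp [h₂ j hj k hk]
      · have : (j = i ∧ k < i' + 1) ↔ (j = i ∧ k < i') := by omega
        rw [if_neg h, h₂ j hj k hk, if_congr this rfl rfl]
    · intro σ₂ _ h₂ j hj k hk
      rw [h₂ j hj k hk, h₁ j hj k hk]
      by_cases hji : j = i
      · simp [hji, hk]
      · have : j < i + 1 ↔ j < i := by omega
        simp [hji, this]
  · intro σ' _ h j hj k hk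
    rw [h j hj k hk, if_pos hj]

/-- The prefix sum of the `e`-th moment up to the endpoint `t`, for the samples after `base`. -/
noncomputable def momentSum (ω : ℕ → ℝ) (σ : State) (K base t e : ℕ) : ℝ :=
  ∑ t' ∈ range t, ∑ i ∈ range K, ω (base + (t' * K + i)) *
    (σ.val 6 0 * σ.val 8 i * ((σ.val 1 (t' + 1) - σ.val 1 t') / 2)) *
    ((σ.val 1 t' + σ.val 1 (t' + 1)) / 2 -
      (σ.val 1 (t' + 1) - σ.val 1 t') / 2 * σ.val 7 i) ^ e

/-- The projection of the `j`-th function, for the samples after `base`. -/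
noncomputable def projection (ω : ℕ → ℝ) (σ : State) (K n D base j : ℕ) : ℝ :=
  ∑ l ∈ range n, ∑ e ∈ range D, σ.val 2 (j * (n * D) + (l * D + e)) *
    (momentSum ω σ K base (σ.idx 2 (j * n + l)) e - momentSum ω σ K base (σ.idx 1 (j * n + l)) e)

/-- Compute all sketches and multiply up their differences. -/
def sketchAll : Program :=
  .forLoop 10 (.var 5) (.seq prefixMoments (.seq projectAll multiplyAll))

/-- Each round draws exactly `S * K` samples, so round `r` starts at sample `r * (S * K)`. The
bounds on the piece indices ensure that only computed rows of prefix sums are read. -/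
theorem runs_sketchAll (ω : ℕ → ℝ) {σ : State} {m n D S K R : ℕ} (hm : σ.idx 0 0 = m)
    (hn : σ.idx 0 1 = n) (hD : σ.idx 8 0 = D) (hS : σ.idx 7 0 = S) (hK : σ.idx 6 0 = K)
    (hR : σ.idx 5 0 = R) (hb : ∀ j < m, ∀ l < n, σ.idx 1 (j * n + l) ≤ S)
    (hc : ∀ j < m, ∀ l < n, σ.idx 2 (j * n + l) ≤ S) (h9 : ∀ e < D, σ.val 9 e = 0)
    (h3 : ∀ j < m, ∀ k < m, σ.val 3 (j * m + k) = 1) (hdr : σ.drawn = 0) :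
    Runs ω sketchAll σ
      ((R + 1) * ((S + 1) * ((D + 1) * 50 + (K + 1) * ((D + 1) * 50 + 70) + 70) +
        ((m + 1) * ((n + 1) * ((D + 1) * 80 + 20) + 30) + (m + 1) * ((m + 1) * 50 + 20)) + 20))
      fun σ' => ∀ j < m, ∀ k < m, σ'.val 3 (j * m + k) = ∏ r ∈ range R,
        (projection ω σ K n D (r * (S * K)) j - projection ω σ K n D (r * (S * K)) k) := by
  refine (Runs.forLoop
    (B := (S + 1) * ((D + 1) * 50 + (K + 1) * ((D + 1) * 50 + 70) + 70) +
        ((m + 1) * ((n + 1) * ((D + 1) * 80 + 20) + 30) + (m + 1) * ((m + 1) * 50 + 20))) (N := R)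
    (Inv := fun r σ' => (∀ e < D, σ'.val 9 e = 0) ∧ σ'.drawn = r * (S * K) ∧
      ∀ j < m, ∀ k < m, σ'.val 3 (j * m + k) = ∏ r' ∈ range r,
        (projection ω σ K n D (r' * (S * K)) j - projection ω σ K n D (r' * (S * K)) k))
    (by simp [IExp.cost]) rfl (fun _ _ _ h => h) ?_ ?_ ?_).mono le_rfl
    (fun σ' _ h => h.2.2)
  · intro σ' hF
    simp [IExp.eval, hF.idx 5 rfl, hR]
  · refine ⟨h9, by simp [hdr], fun j hj k hk => ?_⟩
    simpa using h3 j hj k hk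
  · rintro r hr σ₁ hF₁ hv₁ ⟨h₁, hd₁, hD₁⟩
    refine Runs.seq ((runs_prefixMoments ω (S := S) (D := D) (K := K)
      (by rw [hF₁.idx 7 rfl, hS]) (by rw [hF₁.idx 8 rfl, hD]) (by rw [hF₁.idx 6 rfl, hK])
      h₁).mono le_rfl ?_)
    rintro σ₂ hF₂ ⟨h₂, hd₂⟩
    rw [hd₁] at h₂ hd₂
    simp only [hF₁.val 1 rfl, hF₁.val 6 rfl, hF₁.val 7 rfl, hF₁.val 8 rfl] at h₂
    refine Runs.seq ((runs_projectAll ω (m := m) (n := n) (D := D)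
      (by rw [hF₂.idx 0 rfl, hF₁.idx 0 rfl, hm]) (by rw [hF₂.idx 0 rfl, hF₁.idx 0 rfl, hn])
      (by rw [hF₂.idx 8 rfl, hF₁.idx 8 rfl, hD])).mono le_rfl ?_)
    intro σ₃ hF₃ h₃
    refine (runs_multiplyAll ω (m := m)
      (by rw [hF₃.idx 0 rfl, hF₂.idx 0 rfl, hF₁.idx 0 rfl, hm])).mono le_rfl ?_
    intro σ₄ hF₄ h₄
    refine ⟨fun e he => ?_, ?_, fun j hj k hk => ?_⟩
    · rw [hF₄.val 9 rfl, hF₃.val 9 rfl]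
      simpa using h₂ 0 (Nat.zero_le _) e he
    · rw [hF₄.drawn rfl, hF₃.drawn rfl, hd₂]
      ring
    · have hproj : ∀ j < m, σ₃.val 15 j = projection ω σ K n D (r * (S * K)) j := by
        intro j hj
        rw [h₃ j hj, projection]
        refine Finset.sum_congr rfl fun l hl => Finset.sum_congr rfl fun e he => ?_
        have hl := Finset.mem_range.1 hl
        have he := Finset.mem_range.1 he
        simp only [hF₂.val 2 rfl, hF₁.val 2 rfl, hF₂.idx 1 rfl, hF₁.idx 1 rfl, hF₂.idx 2 rfl,
          hF₁.idx 2 rfl]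
        rw [h₂ _ (hb j hj l hl) e he, h₂ _ (hc j hj l hl) e he]
        rfl
      rw [h₄ j hj k hk, hproj j hj, hproj k hk, hF₃.val 3 rfl, hF₂.val 3 rfl, hD₁ j hj k hk,
        Finset.prod_range_succ]

/-! ## The parameters, the tables and the output -/

open scoped Real

/-- The smallest `E` with `1 ≤ E * ε`. -/
def findAccuracy : Program :=
  .loop (.rlt (.mul (.ofIdx (.var 3)) (.get 0 (.lit 0))) (.ofIdx (.lit 1)))
    (.setI 3 (.add (.var 3) (.lit 1)))

/-- Reals cannot be rounded to integers, so `⌈ε⁻¹⌉` is found by counting; this costs `O(1 / ε)`,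
well within the budget. -/
theorem runs_findAccuracy (ω : ℕ → ℝ) {σ : State} {ε : ℝ} (hε : 0 < ε) (h0 : σ.idx 3 0 = 0)
    (h1 : σ.val 0 0 = ε) : Runs ω findAccuracy σ ((⌈ε⁻¹⌉₊ + 1) * 20) fun σ' =>
      1 ≤ σ'.idx 3 0 * ε ∧ σ'.idx 3 0 ≤ ⌈ε⁻¹⌉₊ := by
  refine (Runs.loop (B := 6) (M := ⌈ε⁻¹⌉₊) (Inv := fun i σ' => σ'.idx 3 0 = i) h0 ?_).mono
    (Nat.mul_le_mul_left _ (by decide)) ?_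
  · intro i σ' hF hi ht
    simp only [Test.Holds, RExp.eval, IExp.eval, hi, hF.val 0 rfl, h1, Nat.cast_one] at ht
    refine ⟨Nat.lt_ceil.2 ?_, Runs.setIdx ?_ (by decide)⟩
    · rwa [← lt_div_iff₀ hε, one_div] at ht
    · simp [IExp.eval, write, hi]
  · rintro σ' hF ⟨i, hi, hI, hnt⟩
    simp only [Test.Holds, RExp.eval, IExp.eval, hI, hF.val 0 rfl, h1, Nat.cast_one,
      not_lt] at hnt
    exact ⟨by rwa [hI], by rwa [hI]⟩

/-- The smallest `L` with `m ≤ 2 ^ L * δ`. -/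
def findConfidence : Program :=
  .seq (.setR 4 (.get 0 (.lit 1))) (.loop (.rlt (.var 4) (.ofIdx (.get 0 (.lit 0))))
    (.seq (.setR 4 (.add (.var 4) (.var 4))) (.setI 4 (.add (.var 4) (.lit 1)))))

theorem runs_findConfidence (ω : ℕ → ℝ) {σ : State} {δ : ℝ} {m : ℕ} (hδ : 0 < δ)
    (h0 : σ.idx 4 0 = 0) (h1 : σ.val 0 1 = δ) (hm : σ.idx 0 0 = m) :
    Runs ω findConfidence σ ((⌈Real.log (m / δ) / Real.log 2⌉₊ + 2) * 30) fun σ' =>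
      m ≤ 2 ^ (σ'.idx 4 0) * δ ∧ σ'.idx 4 0 ≤ ⌈Real.log (m / δ) / Real.log 2⌉₊ := by
  refine Runs.mono (B := 4 + (⌈Real.log (m / δ) / Real.log 2⌉₊ + 1) * 30)
    (Runs.seq (Runs.setVal ?_ (by decide))) (by ring_nf; omega) fun σ' _ h => h
  refine (Runs.loop (B := 7 + 6) (M := ⌈Real.log (m / δ) / Real.log 2⌉₊)
    (Inv := fun i σ' => σ'.idx 4 0 = i ∧ σ'.val 4 0 = 2 ^ i * δ) ?_ ?_).mono
    (Nat.mul_le_mul_left _ (by decide)) ?_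
  · simp [h0, write, IExp.eval, RExp.eval, h1]
  · rintro i σ' hF ⟨hi, hp⟩ ht
    simp only [Test.Holds, RExp.eval, IExp.eval, hp, hF.idx 0 rfl, hm] at ht
    refine ⟨Nat.lt_ceil.2 ?_, Runs.seq (Runs.setVal (Runs.setIdx ?_ (by decide)) (by decide))⟩
    · rw [lt_div_iff₀ (Real.log_pos one_lt_two), ← Real.log_pow]
      exact Real.log_lt_log (by positivity) (by rwa [lt_div_iff₀ hδ])
    · simp only [IExp.eval, RExp.eval, write, hi, hp]
      refine ⟨by simp, ?_⟩
      simp only [and_self, if_true]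
      ring
  · rintro σ' hF ⟨i, hi, ⟨hI, hp⟩, hnt⟩
    simp only [Test.Holds, RExp.eval, IExp.eval, hp, hF.idx 0 rfl, hm, not_lt] at hnt
    rw [hI]
    exact ⟨hnt, hi⟩

/-- A power `K` of two that is at least `100 * D ^ 2 * E`, and the cosine of `π / K`. -/
def findNodes : Program :=
  .seq (.setI 6 (.lit 2)) (.loop
    (.ilt (.var 6) (.mul (.lit 100) (.mul (.mul (.var 8) (.var 8)) (.var 3))))
    (.seq (.setI 6 (.mul (.var 6) (.lit 2)))
      (.setR 5 (.root (.lit 2) (.div (.add (.ofIdx (.lit 1)) (.var 5)) (.ofIdx (.lit 2)))))))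

theorem abs_rpow_half (x : ℝ) : |x| ^ (((2 : ℕ) : ℝ)⁻¹) = √|x| := by
  rw [Real.sqrt_eq_rpow]; norm_num

theorem runs_findNodes (ω : ℕ → ℝ) {σ : State} {D E : ℕ} (hD : σ.idx 8 0 = D)
    (hE : σ.idx 3 0 = E) (hD0 : 0 < D) (hE0 : 0 < E) (h0 : σ.val 5 0 = 0) :
    Runs ω findNodes σ ((100 * D ^ 2 * E + 2) * 50) fun σ' =>
      100 * D ^ 2 * E ≤ σ'.idx 6 0 ∧ σ'.idx 6 0 ≤ 2 * (100 * D ^ 2 * E) ∧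
        σ'.val 5 0 = Real.cos (π / σ'.idx 6 0) := by
  set T := 100 * D ^ 2 * E with hT
  have hT0 : 0 < T := by positivity
  refine Runs.mono (B := 3 + (T + 1) * 50)
    (Runs.seq (Runs.setIdx ?_ (by decide))) (by ring_nf; omega) fun σ' _ h => h
  refine (Runs.loop (B := 6 + 12) (M := T)
    (Inv := fun i σ' => σ'.idx 6 0 = 2 ^ (i + 1) ∧ 2 ^ (i + 1) ≤ 2 * T ∧
      σ'.val 5 0 = Real.cos (π / 2 ^ (i + 1))) ?_ ?_).mono
    (Nat.mul_le_mul_left _ (by decide)) ?_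
  -- The search starts at `K = 2`, where the initial zero cell already contains `cos (π / 2)`.
  · refine ⟨by simp [write, IExp.eval], by omega, ?_⟩
    simp [h0]
  · rintro i σ' hF ⟨hi, hle, hcos⟩ ht
    have a8 : σ'.idx 8 0 = D := by rw [hF.idx 8 rfl]; simpa [write] using hD
    have a3 : σ'.idx 3 0 = E := by rw [hF.idx 3 rfl]; simpa [write] using hE
    simp only [Test.Holds, IExp.eval, hi, a8, a3] at ht
    have ht : 2 ^ (i + 1) < T := by rw [hT]; linarith
    refine ⟨?_, Runs.seq (Runs.setIdx (Runs.setVal ?_ (by decide)) (by decide))⟩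
    -- A linear bound on the number of doublings suffices here.
    · have : i + 1 < 2 ^ (i + 1) := Nat.lt_two_pow_self
      omega
    · simp only [IExp.eval, RExp.eval, write, hi, hcos, and_self, if_true]
      refine ⟨by ring, by rw [pow_succ]; omega, ?_⟩
      have hx : 0 ≤ π / 2 ^ (i + 1) := by positivity
      have hx' : π / 2 ^ (i + 1) ≤ π := div_le_self Real.pi_pos.le (one_le_pow₀ one_le_two)
      rw [abs_rpow_half, pow_succ _ (i + 1), ← div_div,
        Real.cos_half (by linarith [Real.pi_pos]) hx', abs_of_nonneg]
      · norm_num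
      · push_cast
        linarith [Real.neg_one_le_cos (π / 2 ^ (i + 1))]
  · rintro σ' hF ⟨i, hi, ⟨hI, hle, hcos⟩, hnt⟩
    have a8 : σ'.idx 8 0 = D := by rw [hF.idx 8 rfl]; simpa [write] using hD
    have a3 : σ'.idx 3 0 = E := by rw [hF.idx 3 rfl]; simpa [write] using hE
    simp only [Test.Holds, IExp.eval, hI, a8, a3, not_lt] at hnt
    rw [hI]
    refine ⟨by rw [hT]; linarith, hle, ?_⟩
    rw [hcos]
    push_cast
    rfl

/-- The tables of the cosines and sines of the multiples of `π / K`. -/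
def fillTables : Program :=
  .seq (.setR 6 (.root (.lit 2) (.sub (.ofIdx (.lit 1)) (.mul (.var 5) (.var 5))))) (.seq
    (.setR 7 (.ofIdx (.lit 1))) (.forLoop 12 (.var 6) (.seq
      (.setVal 7 (.add (.var 12) (.lit 1)) (.sub (.mul (.get 7 (.var 12)) (.var 5))
        (.mul (.get 8 (.var 12)) (.var 6))))
      (.setVal 8 (.add (.var 12) (.lit 1)) (.add (.mul (.get 8 (.var 12)) (.var 5))
        (.mul (.get 7 (.var 12)) (.var 6)))))))

/-- The sine is the nonnegative root of `1 - cos ^ 2` because `π / K` lies in `[0, π]`; the addition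
formulas do the rest. Cell 0 of the sine table is correct because memory starts at zero. -/
theorem runs_fillTables (ω : ℕ → ℝ) {σ : State} {K : ℕ} (hK : σ.idx 6 0 = K) (hK0 : 0 < K)
    (hcos : σ.val 5 0 = Real.cos (π / K)) (h8 : σ.val 8 0 = 0) :
    Runs ω fillTables σ ((K + 2) * 60) fun σ' => σ'.val 6 0 = Real.sin (π / K) ∧
      ∀ i ≤ K, σ'.val 7 i = Real.cos (i * (π / K)) ∧ σ'.val 8 i = Real.sin (i * (π / K)) := by
  have hKR : (1 : ℝ) ≤ K := by exact_mod_cast hK0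
  have hsin : |1 - Real.cos (π / K) * Real.cos (π / K)| ^ (((2 : ℕ) : ℝ)⁻¹)
      = Real.sin (π / K) := by
    have h1 : 1 - Real.cos (π / K) * Real.cos (π / K) = 1 - Real.cos (π / K) ^ 2 := by ring
    have h2 := Real.sin_sq_add_cos_sq (π / K)
    rw [abs_rpow_half, h1, abs_of_nonneg (by nlinarith [sq_nonneg (Real.sin (π / K))])]
    exact (Real.sin_eq_sqrt_one_sub_cos_sq (by positivity)
      (div_le_self Real.pi_pos.le hKR)).symm
  refine Runs.mono (B := 15 + (5 + (K + 1) * 60))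
    (Runs.seq (Runs.setVal (Runs.seq (Runs.setVal ?_ (by decide))) (by decide)))
    (by ring_nf; omega) fun σ' _ h => h
  simp only [IExp.eval, RExp.eval, hcos, Nat.cast_one, hsin]
  refine (Runs.forLoop (B := 40) (N := K) (Inv := fun k σ' => ∀ i ≤ k,
    σ'.val 7 i = Real.cos (i * (π / K)) ∧ σ'.val 8 i = Real.sin (i * (π / K)))
    (by simp [IExp.cost]) rfl (fun _ _ _ h => h) ?_ ?_ ?_).mono le_rfl ?_
  · intro σ' hF
    simp only [IExp.eval, hF.idx 6 rfl, hK]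
  · intro i hi
    obtain rfl : i = 0 := by omega
    simp [write, h8]
  · rintro k hk σ' hF hv h
    refine Runs.seq (B := 20) (B' := 20)
      (Runs.setVal (Runs.setVal ?_ (by decide)) (by decide))
    have b5 : σ'.val 5 0 = Real.cos (π / K) := by rw [hF.val 5 rfl]; simpa [write] using hcos
    have b6 : σ'.val 6 0 = Real.sin (π / K) := by rw [hF.val 6 rfl]; simp [write]
    obtain ⟨c1, c2⟩ := h k le_rfl
    intro i hi
    rcases Nat.lt_succ_iff_lt_or_eq.1 (Nat.lt_succ_of_le hi) with hlt | rfl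
    · obtain ⟨g1, g2⟩ := h i (by omega)
      have : i ≠ k + 1 := by omega
      simp [write, IExp.eval, hv, this, g1, g2]
    · have hang : ((k + 1 : ℕ) : ℝ) * (π / K) = k * (π / K) + π / K := by push_cast; ring
      simp only [write, IExp.eval, RExp.eval, hv, b5, b6, c1, c2, hang, Real.cos_add, Real.sin_add]
      simp
  · rintro σ' hF h
    exact ⟨by rw [hF.val 6 rfl]; simp [write], h⟩

/-- Initialize the outputs. -/
def initOutput : Program :=
  .forLoop 12 (.mul (.get 0 (.lit 0)) (.get 0 (.lit 0))) (.setVal 3 (.var 12) (.ofIdx (.lit 1)))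

theorem runs_initOutput (ω : ℕ → ℝ) {σ : State} {m : ℕ} (hm : σ.idx 0 0 = m) :
    Runs ω initOutput σ ((m * m + 1) * 30) fun σ' => ∀ q < m * m, σ'.val 3 q = 1 := by
  refine Runs.forLoop (B := 5) (N := m * m) (Inv := fun k σ' => ∀ q < k, σ'.val 3 q = 1)
    (by simp [IExp.cost]) rfl (fun _ _ _ h => h) ?_ (by simp) ?_
  · intro σ' hF
    simp [IExp.eval, hF.idx 0 rfl, hm]
  · rintro k hk σ' hF hv h
    refine Runs.setVal ?_ (by decide)
    intro q hq
    simp only [IExp.eval, RExp.eval, write, hv, true_and]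
    split_ifs with hqk
    · simp
    · exact h q (by omega)

/-- Replace the outputs by their roots. -/
def takeRoots : Program :=
  .forLoop 12 (.mul (.get 0 (.lit 0)) (.get 0 (.lit 0)))
    (.setVal 3 (.var 12) (.root (.var 5) (.get 3 (.var 12))))

theorem runs_takeRoots (ω : ℕ → ℝ) {σ : State} {m R : ℕ} (hm : σ.idx 0 0 = m)
    (hR : σ.idx 5 0 = R) : Runs ω takeRoots σ ((m * m + 1) * 30) fun σ' =>
      ∀ q < m * m, σ'.val 3 q = |σ.val 3 q| ^ ((R : ℝ)⁻¹) := by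
  refine (Runs.forLoop (B := 10) (N := m * m)
    (Inv := fun k σ' => (∀ q < k, σ'.val 3 q = |σ.val 3 q| ^ ((R : ℝ)⁻¹)) ∧
      ∀ q, k ≤ q → σ'.val 3 q = σ.val 3 q)
    (by simp [IExp.cost]) rfl (fun _ _ _ h => h) ?_ (by simp) ?_).mono le_rfl fun _ _ h => h.1
  · intro σ' hF
    simp [IExp.eval, hF.idx 0 rfl, hm]
  · rintro k hk σ' hF hv ⟨h, h'⟩
    refine Runs.setVal ?_ (by decide)
    have a5 : σ'.idx 5 0 = R := by rw [hF.idx 5 rfl, hR]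
    simp only [IExp.eval, RExp.eval, write, hv, a5, h' k le_rfl, true_and]
    refine ⟨fun q hq => ?_, fun q hq => ?_⟩
    · split_ifs with hqk
      · rw [hqk]
      · exact h q (by omega)
    · rw [if_neg (by omega), h' q (by omega)]

/-! ## The whole program -/

theorem divNat_mul_add {k l : ℕ} (j : Fin k) (i : Fin l) (h : (j : ℕ) * l + i < k * l) :
    (⟨(j : ℕ) * l + i, h⟩ : Fin (k * l)).divNat = j := by
  have hl : 0 < l := by have := i.2; omega
  refine Fin.ext ?_
  rw [Fin.coe_divNat]
  simp [mul_comm _ l, Nat.mul_add_div hl, Nat.div_eq_of_lt i.2]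

theorem modNat_mul_add {k l : ℕ} (j : Fin k) (i : Fin l) (h : (j : ℕ) * l + i < k * l) :
    (⟨(j : ℕ) * l + i, h⟩ : Fin (k * l)).modNat = i := by
  refine Fin.ext ?_
  rw [Fin.coe_modNat]
  simp [Nat.mod_eq_of_lt i.2]

theorem mul_add_lt_mul {k l : ℕ} (j : Fin k) (i : Fin l) : (j : ℕ) * l + i < k * l := by
  have : ((j : ℕ) + 1) * l ≤ k * l := Nat.mul_le_mul_right _ j.2
  rw [add_mul] at this
  omega

theorem ofMat_apply {X : Type} [Zero X] {k l : ℕ} (u : Fin k → Fin l → X) (j : Fin k) (i : Fin l) :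
    ofMat u ((j : ℕ) * l + i) = u j i := by
  rw [ofMat, ofVec, dif_pos (mul_add_lt_mul j i), divNat_mul_add, modNat_mul_add]

/-- Rewrites a difference of prefix sums with the same index condition that defines `piecePoly`. -/
theorem sum_range_sub_sum_range {b c S : ℕ} (hbc : b ≤ c) (hc : c ≤ S) (g : ℕ → ℝ) :
    ∑ t ∈ range c, g t - ∑ t ∈ range b, g t
      = ∑ t ∈ range S, if b ≤ t ∧ t < c then g t else 0 := by
  rw [← Finset.sum_Ico_eq_sub g hbc, ← Finset.sum_filter]
  refine Finset.sum_congr ?_ fun _ _ => rfl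
  ext t
  simp only [Finset.mem_Ico, Finset.mem_filter, Finset.mem_range]
  omega

variable {m n d : ℕ} {ε δ : ℝ}

/-- The input data of `F` are in the memory. -/
structure HasData (F : PiecewisePolyFamily m n d) (σ : State) : Prop where
  b : ∀ (j : Fin m) (l : Fin n), σ.idx 1 ((j : ℕ) * n + (l : ℕ)) = F.b j l
  c : ∀ (j : Fin m) (l : Fin n), σ.idx 2 ((j : ℕ) * n + (l : ℕ)) = F.c j l
  a : σ.val 1 = ofVec F.a
  α : ∀ (j : Fin m) (l : Fin n) (i : Fin (d + 1)),
    σ.val 2 ((j : ℕ) * (n * (d + 1)) + ((l : ℕ) * (d + 1) + (i : ℕ))) = F.α j l i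

theorem HasData.congr {F : PiecewisePolyFamily m n d} {σ σ' : State} (h : HasData F σ)
    (h₁ : σ'.idx 1 = σ.idx 1) (h₂ : σ'.idx 2 = σ.idx 2) (h₃ : σ'.val 1 = σ.val 1)
    (h₄ : σ'.val 2 = σ.val 2) : HasData F σ' where
  b := by rw [h₁]; exact h.b
  c := by rw [h₂]; exact h.c
  a := by rw [h₃]; exact h.a
  α := by rw [h₄]; exact h.α

theorem hasData_input (F : PiecewisePolyFamily m n d) : HasData F (input F ε δ) where
  b j l := ofMat_apply (fun j l => (F.b j l : ℕ)) j l
  c j l := ofMat_apply (fun j l => (F.c j l : ℕ)) j l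
  a := rfl
  α j l i := by
    have := ofMat_apply (fun j (q : Fin (n * (d + 1))) => F.α j q.divNat q.modNat) j
      ⟨(l : ℕ) * (d + 1) + i, mul_add_lt_mul l i⟩
    rw [divNat_mul_add, modNat_mul_add] at this
    exact this

/-- The program sums over pieces and exponents first, the sketch over intervals and nodes; after the
prefix differences are expanded, both are the same finite sum in different orders. -/
theorem projection_eq_sketch (F : PiecewisePolyFamily m n d) {σ : State} {K : ℕ}
    (hF : HasData F σ) (h6 : σ.val 6 0 = Real.sin (π / K))
    (h7 : ∀ i < K, σ.val 7 i = Real.cos (i * (π / K)))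
    (h8 : ∀ i < K, σ.val 8 i = Real.sin (i * (π / K))) (ω : ℕ → ℝ) (r : ℕ) (j : Fin m) :
    projection ω σ K n (d + 1) (r * ((F.s - 1) * K)) j = F.sketch K ω r j := by
  set G : ℕ → ℕ → ℝ := fun t e => ∑ i ∈ range K, ω ((r * (F.s - 1) + t) * K + i) *
    F.weight (π / K) t i * F.node (π / K) t i ^ e with hG
  have hmom : ∀ t e, momentSum ω σ K (r * ((F.s - 1) * K)) t e = ∑ t' ∈ range t, G t' e := by
    intro t e
    refine Finset.sum_congr rfl fun t' _ => Finset.sum_congr rfl fun i hi => ?_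
    have hi := Finset.mem_range.1 hi
    rw [h6, h7 i hi, h8 i hi, hF.a,
      show r * ((F.s - 1) * K) + (t' * K + i) = (r * (F.s - 1) + t') * K + i by ring]
    rfl
  have hdiff : ∀ (l : Fin n) e, momentSum ω σ K (r * ((F.s - 1) * K)) (σ.idx 2 (j * n + l)) e -
      momentSum ω σ K (r * ((F.s - 1) * K)) (σ.idx 1 (j * n + l)) e =
      ∑ t ∈ range (F.s - 1), if (F.b j l : ℕ) ≤ t ∧ t < F.c j l then G t e else 0 := by
    intro l e
    rw [hmom, hmom, hF.b, hF.c]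
    exact sum_range_sub_sum_range (F.b_lt_c j l).le (Nat.le_sub_one_of_lt (F.c j l).2) _
  have hL : projection ω σ K n (d + 1) (r * ((F.s - 1) * K)) j = ∑ l : Fin n,
      ∑ e : Fin (d + 1), F.α j l e * ∑ t ∈ range (F.s - 1),
        if (F.b j l : ℕ) ≤ t ∧ t < F.c j l then G t e else 0 := by
    rw [projection, Finset.sum_range]
    refine Finset.sum_congr rfl fun l _ => ?_
    rw [Finset.sum_range]
    refine Finset.sum_congr rfl fun e _ => ?_
    rw [hdiff, hF.α]
  have hR : F.sketch K ω r j = ∑ t ∈ range (F.s - 1), ∑ l : Fin n,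
      ∑ e : Fin (d + 1), F.α j l e *
        if (F.b j l : ℕ) ≤ t ∧ t < F.c j l then G t e else 0 := by
    rw [PiecewisePolyData.sketch]
    refine Finset.sum_congr rfl fun t _ => ?_
    rw [PiecewisePolyData.piecePoly]
    simp only [Polynomial.eval_finsetSum, Finset.mul_sum]
    rw [Finset.sum_comm]
    refine Finset.sum_congr rfl fun l _ => ?_
    by_cases h : (F.b j l : ℕ) ≤ t ∧ t < F.c j l
    · simp only [if_pos h, hG, Polynomial.eval_finsetSum, Finset.mul_sum]
      rw [Finset.sum_comm]
      refine Finset.sum_congr rfl fun e _ => Finset.sum_congr rfl fun i _ => ?_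
      simp
      ring
    · simp [if_neg h]
  rw [hL, hR]
  simp only [Finset.mul_sum]
  rw [Finset.sum_comm (s := range (F.s - 1))]
  exact Finset.sum_congr rfl fun l _ => Finset.sum_comm

/-- Compute the parameters and the tables. -/
def setup (A : ℕ) : Program :=
  .seq (.setI 7 (.sub (.get 0 (.lit 3)) (.lit 1))) (.seq
    (.setI 8 (.add (.get 0 (.lit 2)) (.lit 1))) (.seq findAccuracy (.seq findConfidence (.seq
    (.setI 5 (.mul (.mul (.lit A) (.mul (.var 3) (.var 3))) (.var 4))) (.seq findNodes (.seq
    fillTables initOutput))))))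

/-- The parameters of the algorithm, computed from `m`, `d`, `ε` and `δ`, are in the memory. -/
structure IsReady (A m d : ℕ) (ε δ : ℝ) (e ℓ : ℕ) (σ : State) : Prop where
  accuracy : 1 ≤ σ.idx 3 0 * ε
  accuracy_le : σ.idx 3 0 ≤ e
  confidence : m ≤ 2 ^ (σ.idx 4 0) * δ
  confidence_le : σ.idx 4 0 ≤ ℓ
  numSketches : σ.idx 5 0 = A * σ.idx 3 0 ^ 2 * σ.idx 4 0
  le_numNodes : 100 * (d + 1) ^ 2 * σ.idx 3 0 ≤ σ.idx 6 0
  numNodes_le : σ.idx 6 0 ≤ 200 * (d + 1) ^ 2 * e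
  sinStep : σ.val 6 0 = Real.sin (π / σ.idx 6 0)
  cosTable : ∀ i < σ.idx 6 0, σ.val 7 i = Real.cos (i * (π / σ.idx 6 0))
  sinTable : ∀ i < σ.idx 6 0, σ.val 8 i = Real.sin (i * (π / σ.idx 6 0))
  outputOne : ∀ q < m * m, σ.val 3 q = 1

theorem runs_setup (A : ℕ) {σ : State} {s : ℕ} (ω : ℕ → ℝ) (hε : 0 < ε) (hδ : 0 < δ)
    {e ℓ : ℕ} (he : e = ⌈ε⁻¹⌉₊) (hℓ : ℓ = ⌈Real.log (m / δ) / Real.log 2⌉₊)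
    (i0 : σ.idx 0 0 = m) (i2 : σ.idx 0 2 = d) (i3 : σ.idx 0 3 = s) (v0 : σ.val 0 0 = ε)
    (v1 : σ.val 0 1 = δ) (hi : ∀ B, 3 ≤ B → σ.idx B 0 = 0) (hv : ∀ B, 3 ≤ B → σ.val B 0 = 0) :
    Runs ω (setup A) σ (6 + (6 + ((e + 1) * 20 + ((ℓ + 2) * 30 + (15 +
      ((100 * (d + 1) ^ 2 * e + 2) * 50 + ((200 * (d + 1) ^ 2 * e + 2) * 60 +
        (m * m + 1) * 30))))))) fun σ' =>
      σ'.idx 7 0 = s - 1 ∧ σ'.idx 8 0 = d + 1 ∧ IsReady A m d ε δ e ℓ σ' := by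
  refine Runs.seq (Runs.setIdx (Runs.seq (Runs.setIdx ?_ (by decide))) (by decide))
  have e2 : IExp.eval { σ with idx := write σ.idx 7 0 (s - 1) } (.get 0 (.lit 2)) = d := i2
  simp only [IExp.eval] at e2
  simp only [IExp.eval, i3, e2]
  obtain ⟨σ₀, hσ₀⟩ : ∃ σ₀ : State, σ₀ = { σ with
    idx := write (write σ.idx 7 0 (s - 1)) 8 0 (d + 1) } := ⟨_, rfl⟩
  rw [← hσ₀]
  have z7 : σ₀.idx 7 0 = s - 1 := by rw [hσ₀]; rfl
  have z8 : σ₀.idx 8 0 = d + 1 := by rw [hσ₀]; rfl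
  have z0 : σ₀.idx 0 0 = m := by rw [hσ₀]; exact i0
  have z3 : σ₀.idx 3 0 = 0 := by rw [hσ₀]; exact hi 3 (by decide)
  have z4 : σ₀.idx 4 0 = 0 := by rw [hσ₀]; exact hi 4 (by decide)
  have zv : σ₀.val = σ.val := by rw [hσ₀]
  clear hσ₀ e2
  refine Runs.seq ((runs_findAccuracy ω hε z3 (by rw [zv, v0])).mono (by rw [he])
    fun σ₁ f₁ ⟨p₁, q₁⟩ => Runs.seq ?_)
  refine (runs_findConfidence ω (m := m) hδ (by rw [f₁.idx 4 rfl, z4])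
    (by rw [f₁.val 0 rfl, zv, v1]) (by rw [f₁.idx 0 rfl, z0])).mono
    (by rw [hℓ]) fun σ₂ f₂ ⟨p₂, q₂⟩ => Runs.seq (Runs.setIdx (Runs.seq ?_) ?_)
  swap
  · simp [IExp.cost]
  obtain ⟨σ₃, hσ₃⟩ : ∃ σ₃ : State, σ₃ = { σ₂ with
    idx := write σ₂.idx 5 0 (A * (σ₂.idx 3 0 * σ₂.idx 3 0) * σ₂.idx 4 0) } := ⟨_, rfl⟩
  simp only [IExp.eval]
  rw [← hσ₃]
  have f₃ : (Program.setI 5 (.mul (.mul (.lit A) (.mul (.var 3) (.var 3))) (.var 4))).Frame σ₂ σ₃ :=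
    hσ₃ ▸ (Exec.setIdx (ω := ω) 5 (.lit 0) _ σ₂).frame
  have y5 : σ₃.idx 5 0 = A * (σ₂.idx 3 0 * σ₂.idx 3 0) * σ₂.idx 4 0 := by rw [hσ₃]; rfl
  clear hσ₃
  have y8 : σ₃.idx 8 0 = d + 1 := by rw [f₃.idx 8 rfl, f₂.idx 8 rfl, f₁.idx 8 rfl, z8]
  have y3 : σ₂.idx 3 0 = σ₁.idx 3 0 := by rw [f₂.idx 3 rfl]
  have x3 : σ₃.idx 3 0 = σ₁.idx 3 0 := by rw [f₃.idx 3 rfl, y3]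
  have hE : 0 < σ₁.idx 3 0 := by
    rcases Nat.eq_zero_or_pos (σ₁.idx 3 0) with h | h
    · rw [h] at p₁; norm_num at p₁
    · exact h
  have hle : 100 * (d + 1) ^ 2 * σ₁.idx 3 0 ≤ 100 * (d + 1) ^ 2 * e :=
    Nat.mul_le_mul_left _ (he ▸ q₁)
  refine (runs_findNodes ω y8 x3 (by positivity) hE (by
    rw [f₃.val 5 rfl, f₂.val 5 rfl, f₁.val 5 rfl, zv, hv 5 (by decide)])).mono
    (by gcongr) fun σ₄ f₄ ⟨p₄, q₄, r₄⟩ => Runs.seq ?_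
  have hK : σ₄.idx 6 0 ≤ 200 * (d + 1) ^ 2 * e := by linarith
  refine (runs_fillTables ω (K := σ₄.idx 6 0) rfl (lt_of_lt_of_le (by positivity) p₄) r₄
    (by rw [f₄.val 8 rfl, f₃.val 8 rfl, f₂.val 8 rfl, f₁.val 8 rfl, zv, hv 8 (by decide)])).mono
    (by gcongr) fun σ₅ f₅ ⟨p₅, q₅⟩ => ?_
  refine (runs_initOutput ω (m := m) (by rw [f₅.idx 0 rfl, f₄.idx 0 rfl, f₃.idx 0 rfl,
    f₂.idx 0 rfl, f₁.idx 0 rfl, z0])).mono le_rfl fun σ₆ f₆ p₆ => ?_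
  have w3 : σ₆.idx 3 0 = σ₁.idx 3 0 := by rw [f₆.idx 3 rfl, f₅.idx 3 rfl, f₄.idx 3 rfl, x3]
  have w4 : σ₆.idx 4 0 = σ₂.idx 4 0 := by
    rw [f₆.idx 4 rfl, f₅.idx 4 rfl, f₄.idx 4 rfl, f₃.idx 4 rfl]
  have w5 : σ₆.idx 5 0 = A * (σ₂.idx 3 0 * σ₂.idx 3 0) * σ₂.idx 4 0 := by
    rw [f₆.idx 5 rfl, f₅.idx 5 rfl, f₄.idx 5 rfl, y5]
  have w6 : σ₆.idx 6 0 = σ₄.idx 6 0 := by rw [f₆.idx 6 rfl, f₅.idx 6 rfl]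
  refine ⟨?_, ?_, ?_⟩
  · rw [f₆.idx 7 rfl, f₅.idx 7 rfl, f₄.idx 7 rfl, f₃.idx 7 rfl, f₂.idx 7 rfl, f₁.idx 7 rfl, z7]
  · rw [f₆.idx 8 rfl, f₅.idx 8 rfl, f₄.idx 8 rfl, y8]
  · refine ⟨by rw [w3]; exact p₁, by rw [w3, he]; exact q₁, by rw [w4]; exact p₂,
      by rw [w4, hℓ]; exact q₂, by rw [w5, w4, w3, y3, pow_two], by rw [w6, w3]; exact p₄,
      by rw [w6]; exact hK, by rw [w6, f₆.val 6 rfl]; exact p₅, fun i h => ?_, fun i h => ?_, p₆⟩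
    · rw [w6] at h ⊢
      rw [f₆.val 7 rfl]
      exact (q₅ i h.le).1
    · rw [w6] at h ⊢
      rw [f₆.val 8 rfl]
      exact (q₅ i h.le).2

/-- A program that draws no samples does not depend on the source of the samples. -/
theorem Exec.of_not_draws {ω ω' : ℕ → ℝ} {p : Program} {σ σ' : State} {N : ℕ}
    (h : Exec ω p σ σ' N) (hp : p.draws = false) : Exec ω' p σ σ' N := by
  induction h with
  | skip σ => exact .skip σ
  | setIdx A i e σ => exact .setIdx A i e σ
  | setVal A i e σ => exact .setVal A i e σ
  | draw A i σ => simp [Program.draws] at hp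
  | seq _ _ ihp ihq =>
    simp only [Program.draws, Bool.or_eq_false_iff] at hp
    exact .seq (ihp hp.1) (ihq hp.2)
  | ite_true ht _ ih =>
    simp only [Program.draws, Bool.or_eq_false_iff] at hp
    exact .ite_true ht (ih hp.1)
  | ite_false ht _ ih =>
    simp only [Program.draws, Bool.or_eq_false_iff] at hp
    exact .ite_false ht (ih hp.2)
  | loop_true ht _ _ ihp ihl => exact .loop_true ht (ihp hp) (ihl hp)
  | loop_false ht => exact .loop_false ht

/-- The whole computation. -/
def approximateDistances (A : ℕ) : Program := .seq (setup A) (.seq sketchAll takeRoots)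

theorem runs_approximateDistances (A : ℕ) (F : PiecewisePolyFamily m n d)
    (hε : 0 < ε) (hδ : 0 < δ) {e ℓ B : ℕ} (he : e = ⌈ε⁻¹⌉₊)
    (hℓ : ℓ = ⌈Real.log (m / δ) / Real.log 2⌉₊)
    (hB : ∀ S K R, S ≤ 2 * m * n → K ≤ 200 * (d + 1) ^ 2 * e → R ≤ A * e ^ 2 * ℓ →
      6 + (6 + ((e + 1) * 20 + ((ℓ + 2) * 30 + (15 +
        ((100 * (d + 1) ^ 2 * e + 2) * 50 + ((200 * (d + 1) ^ 2 * e + 2) * 60 +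
        (m * m + 1) * 30)))))) + ((R + 1) * ((S + 1) * ((d + 1 + 1) * 50 +
        (K + 1) * ((d + 1 + 1) * 50 + 70) + 70) + ((m + 1) * ((n + 1) * ((d + 1 + 1) * 80 + 20) +
        30) + (m + 1) * ((m + 1) * 50 + 20)) + 20) + (m * m + 1) * 30) ≤ B) :
    ∃ E L K R : ℕ, 1 ≤ E * ε ∧ m ≤ 2 ^ L * δ ∧ 100 * (d + 1) ^ 2 * E ≤ K ∧
      R = A * E ^ 2 * L ∧ ∀ ω, Runs ω (approximateDistances A) (input F ε δ) B fun σ =>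
        output m σ = fun j k =>
          |∏ r ∈ range R, (F.sketch K ω r j - F.sketch K ω r k)| ^ ((R : ℝ)⁻¹) := by
  -- The setup is run on the zero sequence of samples. It draws nothing, so its run, and hence `E`,
  -- `L`, `K`, `R`, is the same for every `ω`; this permits choosing them before `ω`.
  obtain ⟨σ, N, hex, hN, h7, h8, h⟩ := runs_setup (σ := input F ε δ) (m := m) (d := d) (ε := ε)
    (δ := δ) (s := F.s) A 0 hε hδ he hℓ (by simp [input, ofVec]) (by simp [input, ofVec])
    (by simp [input, ofVec]) (by simp [input, ofVec]) (by simp [input, ofVec])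
    (fun B hB => by match B, hB with | _ + 3, _ => rfl)
    (fun B hB => by match B, hB with | _ + 3, _ => rfl)
  have hF := hex.frame
  have hdata : HasData F σ :=
    (hasData_input F).congr (hF.idx 1 rfl) (hF.idx 2 rfl) (hF.val 1 rfl) (hF.val 2 rfl)
  have i0 : σ.idx 0 0 = m := by rw [hF.idx 0 rfl]; simp [input, ofVec]
  have i1 : σ.idx 0 1 = n := by rw [hF.idx 0 rfl]; simp [input, ofVec]
  refine ⟨σ.idx 3 0, σ.idx 4 0, σ.idx 6 0, σ.idx 5 0, h.accuracy, h.confidence, h.le_numNodes,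
    h.numSketches, fun ω => ?_⟩
  obtain ⟨σ', N', hex', hN', h'⟩ := runs_sketchAll ω (σ := σ) i0 i1 h8 h7 rfl rfl
    (fun j hj l hl => by
      rw [hdata.b ⟨j, hj⟩ ⟨l, hl⟩]; exact Nat.le_sub_one_of_lt (F.b ⟨j, hj⟩ ⟨l, hl⟩).2)
    (fun j hj l hl => by
      rw [hdata.c ⟨j, hj⟩ ⟨l, hl⟩]; exact Nat.le_sub_one_of_lt (F.c ⟨j, hj⟩ ⟨l, hl⟩).2)
    (fun q _ => by rw [hF.val 9 rfl]; rfl)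
    (fun j hj k hk => h.outputOne _ (mul_add_lt_mul ⟨j, hj⟩ ⟨k, hk⟩))
    (by rw [hF.drawn rfl]; rfl)
  have hF' := hex'.frame
  obtain ⟨σ'', N'', hex'', hN'', h''⟩ := runs_takeRoots ω (σ := σ') (m := m) (R := σ.idx 5 0)
    (by rw [hF'.idx 0 rfl, i0]) (by rw [hF'.idx 5 rfl])
  refine ⟨σ'', _, .seq (hex.of_not_draws rfl) (.seq hex' hex''), ?_, ?_⟩
  · refine le_trans ?_ (hB (F.s - 1) (σ.idx 6 0) (σ.idx 5 0) ((Nat.sub_le _ _).trans F.s_le)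
      h.numNodes_le ?_)
    · exact add_le_add hN (add_le_add hN' hN'')
    · rw [h.numSketches]
      exact Nat.mul_le_mul (Nat.mul_le_mul_left _ (Nat.pow_le_pow_left h.accuracy_le 2))
        h.confidence_le
  · funext j k
    rw [output, h'' _ (mul_add_lt_mul j k), h' j j.2 k k.2]
    simp_rw [projection_eq_sketch F hdata h.sinStep h.cosTable h.sinTable]

/-! ### The operation count -/

/-- With `W = m * (m + n)` and `D = d + 1`, one round is dominated by `S * K * D = O(W * D ^ 3 *
e)`, the projections and the pairs cost `O(W * D)` and `O(W)`, and there are at most `A * e ^ 2 * ℓ`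
rounds. -/
theorem cost_le {A e ℓ S K R : ℕ} (hA : 0 < A) (he : 0 < e) (hℓ : 0 < ℓ) (hm : 2 ≤ m)
    (hS : S ≤ 2 * m * n) (hK : K ≤ 200 * (d + 1) ^ 2 * e) (hR : R ≤ A * e ^ 2 * ℓ) :
      6 + (6 + ((e + 1) * 20 + ((ℓ + 2) * 30 + (15 +
        ((100 * (d + 1) ^ 2 * e + 2) * 50 + ((200 * (d + 1) ^ 2 * e + 2) * 60 +
        (m * m + 1) * 30)))))) + ((R + 1) * ((S + 1) * ((d + 1 + 1) * 50 +
        (K + 1) * ((d + 1 + 1) * 50 + 70) + 70) + ((m + 1) * ((n + 1) * ((d + 1 + 1) * 80 + 20) +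
        30) + (m + 1) * ((m + 1) * 50 + 20)) + 20) + (m * m + 1) * 30)
      ≤ 200000 * (A * e ^ 3 * ℓ * (m * (m + n)) * (d + 1) ^ 3) := by
  have hD : 0 < d + 1 := Nat.succ_pos d
  generalize d + 1 = D at *
  obtain ⟨W, hW⟩ : ∃ W, W = m * (m + n) := ⟨_, rfl⟩
  rw [← hW]
  have hmW : m * m + m * n = W := by rw [hW]; ring
  have hW0 : 4 ≤ W := by nlinarith
  have hmm : m * m ≤ W := by nlinarith
  have hSW : S + 1 ≤ 2 * W := by nlinarith
  have hmn : (m + 1) * (n + 1) ≤ 2 * W := by nlinarith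
  have hm1 : (m + 1) * (m + 1) ≤ 4 * W := by nlinarith
  have hm2 : m + 1 ≤ W := by nlinarith
  have hDe : 0 < D ^ 2 * e := by positivity
  have hK1 : K + 1 ≤ 201 * (D ^ 2 * e) := by linarith
  have hD1 : (D + 1) * 50 + 70 ≤ 170 * D := by omega
  have hKD : (K + 1) * ((D + 1) * 50 + 70) ≤ 34170 * (D ^ 3 * e) :=
    (Nat.mul_le_mul hK1 hD1).trans (le_of_eq (by ring))
  have hD3 : D ≤ D ^ 3 * e :=
    (Nat.le_self_pow (by decide) D).trans (Nat.le_mul_of_pos_right _ he)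
  have hD32 : D ^ 2 * e ≤ D ^ 3 * e := by gcongr; omega
  have hY : (D + 1) * 50 + (K + 1) * ((D + 1) * 50 + 70) + 70 ≤ 34340 * (D ^ 3 * e) := by omega
  have h1 : (S + 1) * ((D + 1) * 50 + (K + 1) * ((D + 1) * 50 + 70) + 70)
      ≤ 68680 * (W * (D ^ 3 * e)) :=
    (Nat.mul_le_mul hSW hY).trans (le_of_eq (by ring))
  have hWD : W * D ≤ W * (D ^ 3 * e) := Nat.mul_le_mul_left _ hD3
  have hWW : W ≤ W * D := Nat.le_mul_of_pos_right _ hD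
  have h2 : (m + 1) * ((n + 1) * ((D + 1) * 80 + 20) + 30) ≤ 390 * (W * D) := by
    have : (m + 1) * (n + 1) * ((D + 1) * 80 + 20) ≤ 2 * W * (180 * D) :=
      Nat.mul_le_mul hmn (by omega)
    calc _ = (m + 1) * (n + 1) * ((D + 1) * 80 + 20) + (m + 1) * 30 := by ring
      _ ≤ 2 * W * (180 * D) + W * D * 30 := by gcongr; omega
      _ = _ := by ring
  have h3 : (m + 1) * ((m + 1) * 50 + 20) ≤ 220 * W := by
    calc _ = (m + 1) * (m + 1) * 50 + (m + 1) * 20 := by ring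
      _ ≤ _ := by omega
  have h4 : (S + 1) * ((D + 1) * 50 + (K + 1) * ((D + 1) * 50 + 70) + 70) +
      ((m + 1) * ((n + 1) * ((D + 1) * 80 + 20) + 30) + (m + 1) * ((m + 1) * 50 + 20)) + 20
      ≤ 70000 * (W * (D ^ 3 * e)) := by
    refine (Nat.add_le_add_right (Nat.add_le_add h1 (Nat.add_le_add h2 h3)) 20).trans ?_
    omega
  have hR0 : 0 < A * e ^ 2 * ℓ := by positivity
  have hR1 : R + 1 ≤ 2 * (A * e ^ 2 * ℓ) := by omega
  generalize (S + 1) * ((D + 1) * 50 + (K + 1) * ((D + 1) * 50 + 70) + 70) +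
    ((m + 1) * ((n + 1) * ((D + 1) * 80 + 20) + 30) + (m + 1) * ((m + 1) * 50 + 20)) + 20 = Y
    at h4 ⊢
  have h5 : (R + 1) * Y ≤ 140000 * (A * e ^ 3 * ℓ * W * D ^ 3) := by
    calc (R + 1) * Y ≤ 2 * (A * e ^ 2 * ℓ) * (70000 * (W * (D ^ 3 * e))) := Nat.mul_le_mul hR1 h4
      _ = _ := by ring
  clear h1 h2 h3 h4 hY hKD
  have g1 : e ≤ D ^ 2 * e := Nat.le_mul_of_pos_left _ (by positivity)
  have g2 : ℓ ≤ A * e ^ 3 * ℓ * W * D ^ 3 := by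
    calc ℓ = 1 * ℓ * 1 * 1 := by ring
      _ ≤ A * e ^ 3 * ℓ * W * D ^ 3 := by
        gcongr <;> first | omega | exact Nat.succ_le_of_lt (by positivity)
  have g3 : D ^ 3 * e ≤ A * e ^ 3 * ℓ * W * D ^ 3 := by
    calc D ^ 3 * e = 1 * e * 1 * 1 * D ^ 3 := by ring
      _ ≤ A * e ^ 3 * ℓ * W * D ^ 3 := by
        gcongr <;> first | omega | exact Nat.le_self_pow (by decide) e
  have g4 : W ≤ A * e ^ 3 * ℓ * W * D ^ 3 := by
    calc W = 1 * 1 * W * 1 := by ring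
      _ ≤ A * e ^ 3 * ℓ * W * D ^ 3 := by
        gcongr <;> first | omega | exact Nat.succ_le_of_lt (by positivity)
  rw [mul_assoc 100, mul_assoc 200]
  omega

end RealRAM

theorem theorem5p1 :
    ∃ (P : RealRAM.Program) (C : ℝ), ∀ (m n d : ℕ) (F : PiecewisePolyFamily m n d) (ε δ : ℝ),
      2 ≤ m → 1 ≤ d → 0 < ε → ε < 1 → 0 < δ → δ < 1 →
      ∃ final : (ℕ → ℝ) → RealRAM.State,
        (∀ ω, ∃ N : ℕ, RealRAM.Exec ω P (RealRAM.input F ε δ) (final ω) N ∧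
          (N : ℝ) ≤ C * (m * (m + n) * d ^ 3 * ε⁻¹ ^ 3 * Real.log (m / δ))) ∧
        HasProbAtLeast RealRAM.cauchySamples
          {ω | IsRelErrApprox F ε (RealRAM.output m (final ω))} (1 - δ) := by
  obtain ⟨A, hA, h⟩ := exists_sketch_number
  -- The factor `192 = 2 ^ 3 * 3 * 2 ^ 3` comes from `⌈ε⁻¹⌉ ≤ 2 * ε⁻¹`, from the bound `3 * log (m /
  -- δ)` for the rounded binary logarithm, and from `d + 1 ≤ 2 * d`.
  refine ⟨RealRAM.approximateDistances A, 200000 * (192 * A), ?_⟩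
  intro m n d F ε δ hm hd hε hε1 hδ hδ1
  have hmR : (2 : ℝ) ≤ m := by exact_mod_cast hm
  have hmδ : 2 ≤ m / δ := by rw [le_div_iff₀ hδ]; nlinarith
  have hlog : Real.log 2 ≤ Real.log (m / δ) := Real.log_le_log two_pos hmδ
  have hlog2 := Real.log_two_gt_d9
  have hℓ0 : 1 ≤ Real.log (m / δ) / Real.log 2 := (one_le_div (Real.log_pos one_lt_two)).2 hlog
  have hε0 : 1 ≤ ε⁻¹ := (one_le_inv₀ hε).2 hε1.le
  obtain ⟨E, L, K, R, hE, hL, hK, hR, hrun⟩ := RealRAM.runs_approximateDistances A F hε hδ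
    rfl rfl fun S K R hS hK hR => RealRAM.cost_le hA (Nat.ceil_pos.2 (by positivity))
      (Nat.ceil_pos.2 (by linarith)) hm hS hK hR
  choose final N hex hN hout using hrun
  refine ⟨final, fun ω => ⟨N ω, hex ω, ?_⟩, ?_⟩
  · have he : (⌈ε⁻¹⌉₊ : ℝ) ≤ 2 * ε⁻¹ := by
      linarith [Nat.ceil_lt_add_one (inv_nonneg.2 hε.le)]
    have hℓ : (⌈Real.log (m / δ) / Real.log 2⌉₊ : ℝ) ≤ 3 * Real.log (m / δ) := by
      have h1 := Nat.ceil_lt_add_one (zero_le_one.trans hℓ0)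
      have h2 : Real.log (m / δ) / Real.log 2 ≤ 1.5 * Real.log (m / δ) := by
        rw [div_le_iff₀ (Real.log_pos one_lt_two)]
        nlinarith
      linarith
    have hdR : (d : ℝ) + 1 ≤ 2 * d := by
      have : (1 : ℝ) ≤ d := by exact_mod_cast hd
      linarith
    have hlog0 : 0 ≤ Real.log (m / δ) := by linarith
    calc (N ω : ℝ) ≤ 200000 * (A * (⌈ε⁻¹⌉₊ : ℝ) ^ 3 * ⌈Real.log (m / δ) / Real.log 2⌉₊ *
          (m * (m + n)) * (d + 1) ^ 3) := by exact_mod_cast hN ω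
      _ ≤ 200000 * (A * (2 * ε⁻¹) ^ 3 * (3 * Real.log (m / δ)) * (m * (m + n)) *
          (2 * d) ^ 3) := by gcongr
      _ = _ := by ring
  · simp only [hout]
    exact h m n d F ε δ E L K R hm hε hε1 hδ hδ1 hE hL hK hR
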